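/- Let $p$ be a prime, let $k$ be the field with $p$ elements, and let $G$ and $H$ be finite $p$-groups. Suppose that $G$ is generated by two elements and that the group algebras $kG$ and $kH$ are isomorphic as $k$-algebras. Then $$G/\gamma_2(G)^p\gamma_4(G)\;\cong\;H/\gamma_2(H)^p\gamma_4(H),$$ where $\gamma_1(X)=X$, $\gamma_{i+1}(X)=[\gamma_i(X),X]$ is the lower central series of a group $X$, and $\gamma_2(X)^p$ is the subgroup generated by the $p$-th powers of the elements of $\gamma_2(X)$. -/

import Mathlib

namespace BaginskiInvariant

/-- The `i`-th term `γ_i(G)` of the lower central series, with `γ_1(G) = G` and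
`γ_{i+1}(G) = [γ_i(G), G]`. Mathlib's series starts at index `0`. -/
def gam (i : ℕ) (G : Type*) [Group G] : Subgroup G :=
  (⊤ : Subgroup G).lowerCentralSeries (i - 1)

/-- `K ^ n`: the subgroup generated by the `n`-th powers of the elements of `K`. -/
def powSubgroup {G : Type*} [Group G] (K : Subgroup G) (n : ℕ) : Subgroup G :=
  Subgroup.closure ((fun x : G => x ^ n) '' (K : Set G))

instance gam_normal (i : ℕ) (G : Type*) [Group G] : (gam i G).Normal := by
  unfold gam; infer_instance

instance powSubgroup_normal {G : Type*} [Group G] (K : Subgroup G) [K.Normal] (n : ℕ) :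
    (powSubgroup K n).Normal := by
  refine ⟨fun x hx g => ?_⟩
  have hle : powSubgroup K n ≤ (powSubgroup K n).comap (MulAut.conj g).toMonoidHom := by
    refine (Subgroup.closure_le _).2 ?_
    rintro _ ⟨y, hy, rfl⟩
    refine Subgroup.subset_closure ⟨g * y * g⁻¹, Subgroup.Normal.conj_mem ‹K.Normal› y hy g, ?_⟩
    simp [conj_pow]
  simpa using hle hx

/-- `γ₂(G)^p γ₄(G)`, the product of two normal subgroups of `G`. -/
def kernelSubgroup (p : ℕ) (G : Type*) [Group G] : Subgroup G :=
  powSubgroup (gam 2 G) p ⊔ gam 4 G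

instance kernelSubgroup_normal (p : ℕ) (G : Type*) [Group G] : (kernelSubgroup p G).Normal := by
  unfold kernelSubgroup; infer_instance

end BaginskiInvariant

/-! Let D be the augmentation ideal of the group algebra and J the ideal generated by ring
commutators, so that dividing by J gives the group algebra of the abelianization. Put A = kG/(DJ +
JDD), keep the name D for the augmentation ideal of A, and let M be the image of J. Over the prime
field every ring homomorphism between group algebras of p-groups respects augmentations
(`aug_map_eq`), so an isomorphism of group algebras makes A the corresponding quotient for G and for
H at once. In A one has DM = 0 and MDD = 0, hence M² = 0, and n ↦ n - 1 is a homomorphism from γ₂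
onto the additive group of M with kernel γ₂^p γ₄ (`exists_rho_eq`, `rho_eq_one_iff`). Both quotients
therefore embed in the units of A, their images contain 1 + M, and their order is |M| times the
order of the abelianization, which A/M determines.

The two images need not coincide, so the isomorphism is built as a subgroup of the product. Take
generators c, d of H adapted to a splitting of its abelianization into cyclic groups of orders p^m ≥
p^n. The heart is `exists_match`: there are a', b' in G, congruent to c, d modulo D², with the same
p^m-th and p^n-th power respectively and the same ring commutator in A. Conjugation on 1 + M depends
only on the class modulo D², so the group generated by (a', c) and (b', d) normalizes the group T of
pairs with equal image in 1 + M. It has order at most |M| p^(m+n) and projects onto both factors, so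
it is the graph of an isomorphism (`nonempty_mulEquiv_of_pairs`).

For the matching: when p^k ≥ 3, the p^k-th power is additive on y + z with z in D²
(`add_pow_of_mem_sq`), which settles the exponent m; the exponent n < m needs a finer choice of b'
(`exists_pow_eq`). Commutators of congruent elements differ by an element of MD. As D is spanned
modulo D² by two elements X, Y, the group MD is spanned by [X, Y]X and [X, Y]Y, and the discrepancy
can be absorbed by factors from 1 + M. The case p^n = 2 is separate, because squaring is not
additive. -/

namespace BaginskiInvariant

/-! ### Powers and commutators in a ring with DM = 0 and MDD = 0 -/

/-- In a commutative ring of prime characteristic `p`, the homogeneous geometric sum of length `p`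
in `a` and `b` is `(a - b) ^ (p - 1)`. -/
theorem geom_sum₂_eq_sub_pow_of_char {B : Type*} [CommRing B] (p : ℕ) [Fact p.Prime] [CharP B p]
    (a b : B) : ∑ i ∈ Finset.range p, a ^ i * b ^ (p - 1 - i) = (a - b) ^ (p - 1) := by
  have key : ∑ i ∈ Finset.range p, (MvPolynomial.X 0 : MvPolynomial (Fin 2) (ZMod p)) ^ i *
      MvPolynomial.X 1 ^ (p - 1 - i) = (MvPolynomial.X 0 - MvPolynomial.X 1) ^ (p - 1) := by
    -- The identity is proved in the generic case, where X₀ - X₁ can be cancelled, and then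
    -- specialized.
    have hne : (MvPolynomial.X 0 - MvPolynomial.X 1 : MvPolynomial (Fin 2) (ZMod p)) ≠ 0 := by
      rw [sub_ne_zero]
      intro h
      exact absurd (MvPolynomial.X_injective h) (by decide)
    apply mul_right_cancel₀ hne
    rw [geom_sum₂_mul, ← pow_succ, Nat.sub_add_cancel (Fact.out : p.Prime).one_le, sub_pow_char]
  have := congrArg (MvPolynomial.eval₂Hom (ZMod.castHom (dvd_refl p) B) ![a, b]) key
  simpa using this

/-- Two ideals `M ≤ D²` of a ring such that the ring is commutative modulo `M` and the products
`D M` and `M D D` vanish. -/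
structure IsSmall {A : Type*} [Ring A] (D M : Ideal A) : Prop where
  right_D : ∀ {x : A} (a : A), x ∈ D → x * a ∈ D
  right_M : ∀ {x : A} (a : A), x ∈ M → x * a ∈ M
  M_le : M ≤ D * D
  comm : ∀ x y : A, x * y - y * x ∈ M
  D_mul_M : ∀ {x m : A}, x ∈ D → m ∈ M → x * m = 0
  M_mul_D_mul_D : ∀ {m x y : A}, m ∈ M → x ∈ D → y ∈ D → m * x * y = 0

namespace IsSmall

variable {A : Type*} [Ring A] {D M : Ideal A}

@[elab_as_elim]
theorem sq_induction {C : A → Prop} {z : A} (hz : z ∈ D * D)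
    (hmul : ∀ x ∈ D, ∀ y ∈ D, C (x * y)) (hadd : ∀ x y, C x → C y → C (x + y)) : C z :=
  Submodule.smul_induction_on hz hmul hadd

theorem sq_le (h : IsSmall D M) : D * D ≤ D := by
  intro z hz
  exact sq_induction hz (fun x hx y _ => h.right_D y hx) (fun x y hx hy => D.add_mem hx hy)

theorem right_sq (h : IsSmall D M) {z : A} (a : A) (hz : z ∈ D * D) : z * a ∈ D * D := by
  refine sq_induction hz (fun x hx y hy => ?_) (fun x y hx hy => ?_)
  · rw [mul_assoc]
    exact Ideal.mul_mem_mul hx (h.right_D a hy)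
  · rw [add_mul]
    exact Ideal.add_mem _ hx hy

theorem M_le_D (h : IsSmall D M) : M ≤ D := h.M_le.trans h.sq_le

theorem M_mul_M (h : IsSmall D M) {m n : A} (hm : m ∈ M) (hn : n ∈ M) : m * n = 0 :=
  h.D_mul_M (h.M_le_D hm) hn

theorem M_mul_sq (h : IsSmall D M) {m z : A} (hm : m ∈ M) (hz : z ∈ D * D) : m * z = 0 := by
  refine sq_induction hz (fun x hx y hy => ?_) (fun x y hx hy => ?_)
  · rw [← mul_assoc]
    exact h.M_mul_D_mul_D hm hx hy
  · rw [mul_add, hx, hy, add_zero]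

/-- A left factor from D kills commutators, so everything to its right may be permuted. -/
theorem mul_right_comm' (h : IsSmall D M) {x : A} (hx : x ∈ D) (a b : A) :
    x * (a * b) = x * (b * a) := by
  rw [← sub_eq_zero, ← mul_sub]
  exact h.D_mul_M hx (h.comm a b)

theorem pow_mem (h : IsSmall D M) {x : A} (hx : x ∈ D) {k : ℕ} (hk : k ≠ 0) : x ^ k ∈ D := by
  obtain ⟨k, rfl⟩ := Nat.exists_eq_succ_of_ne_zero hk
  rw [pow_succ']
  exact h.right_D _ hx

theorem pow_mem_sq (h : IsSmall D M) {x : A} (hx : x ∈ D) {k : ℕ} (hk : 2 ≤ k) :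
    x ^ k ∈ D * D := by
  obtain ⟨k, rfl⟩ := Nat.exists_eq_add_of_le hk
  rw [pow_add, sq]
  exact h.right_sq _ (Ideal.mul_mem_mul hx hx)

/-- The commutator of an element of `D` with one of `D²` lies in `M D`. -/
theorem comm_mem_M_mul_D (h : IsSmall D M) (y : A) {z : A} (hz : z ∈ D * D) :
    y * z - z * y ∈ M * D := by
  refine sq_induction hz (fun a ha b hb => ?_) (fun a b ha hb => ?_)
  · have : y * (a * b) - a * b * y = (y * a - a * y) * b + a * (y * b - b * y) := by
      noncomm_ring
    rw [this, h.D_mul_M ha (h.comm _ _), add_zero]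
    exact Ideal.mul_mem_mul (h.comm _ _) hb
  · have : y * (a + b) - (a + b) * y = (y * a - a * y) + (y * b - b * y) := by noncomm_ring
    rw [this]
    exact Ideal.add_mem _ ha hb

theorem M_mul_D_mul (h : IsSmall D M) {z v : A} (hz : z ∈ M * D) (hv : v ∈ D) : z * v = 0 := by
  refine Submodule.smul_induction_on hz (fun m hm x hx => h.M_mul_D_mul_D hm hx hv)
    (fun x y hx hy => ?_)
  rw [add_mul, hx, hy, add_zero]

/-- Expand [ab, v] = a[b, v] + [a, v]b: the first term lies in DM, the second in MDD because [a, v]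
is in MD for v in D². -/
theorem sq_comm (h : IsSmall D M) {u v : A} (hu : u ∈ D * D) (hv : v ∈ D * D) :
    Commute u v := by
  rw [commute_iff_eq, ← sub_eq_zero]
  refine sq_induction hu (fun a ha b hb => ?_) (fun a b ha hb => ?_)
  · have : a * b * v - v * (a * b) = a * (b * v - v * b) + (a * v - v * a) * b := by
      noncomm_ring
    rw [this, h.D_mul_M ha (h.comm _ _), h.M_mul_D_mul (h.comm_mem_M_mul_D a hv) hb, add_zero]
  · have : (a + b) * v - v * (a + b) = (a * v - v * a) + (b * v - v * b) := by noncomm_ring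
    rw [this, ha, hb, add_zero]

/-- Products from D · D² are central, since the two terms of the Leibniz expansion lie in M D² and
DM. -/
theorem commute_mul (h : IsSmall D M) (y : A) {a b : A} (ha : a ∈ D)
    (hb : b ∈ D * D) : Commute y (a * b) := by
  rw [commute_iff_eq, ← sub_eq_zero]
  have : y * (a * b) - a * b * y = (y * a - a * y) * b + a * (y * b - b * y) := by
    noncomm_ring
  rw [this, h.D_mul_M ha (h.comm _ _), h.M_mul_sq (h.comm _ _) hb, add_zero]

theorem mul_pow (h : IsSmall D M) {x : A} (hx : x ∈ D) (y : A) (k : ℕ) :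
    (x * y) ^ k = x ^ k * y ^ k := by
  induction k with
  | zero => simp
  | succ k ih =>
    rw [pow_succ', ih, mul_assoc, ← mul_assoc y, ← mul_assoc, h.mul_right_comm' hx y, pow_succ',
      pow_succ']
    noncomm_ring

variable {p : ℕ} [Fact p.Prime] [CharP A p]

theorem add_pow_of_sq (h : IsSmall D M) {u v : A} (hu : u ∈ D * D) (hv : v ∈ D * D) (k : ℕ) :
    (u + v) ^ p ^ k = u ^ p ^ k + v ^ p ^ k :=
  add_pow_char_pow_of_commute _ _ (h.sq_comm hu hv)

theorem M_pow (h : IsSmall D M) {m : A} (hm : m ∈ M) {k : ℕ} (hk : 2 ≤ k) : m ^ k = 0 := by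
  obtain ⟨k, rfl⟩ := Nat.exists_eq_add_of_le hk
  rw [pow_add, sq, h.M_mul_M hm hm, zero_mul]

theorem two_le_prime_pow {k : ℕ} (hk : k ≠ 0) : 2 ≤ p ^ k :=
  (Fact.out : p.Prime).two_le.trans (Nat.le_self_pow hk p)

/-- `M` contains the difference between a geometric sum and the corresponding power. -/
theorem geom_sum₂_sub_mem (h : IsSmall D M) (a b : A) :
    ∑ i ∈ Finset.range p, a ^ i * b ^ (p - 1 - i) - (a - b) ^ (p - 1) ∈ M := by
  have : M.IsTwoSided := ⟨fun b ha => h.right_M b ha⟩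
  let : CommRing (A ⧸ M) :=
    { Ideal.Quotient.ring M with
      mul_comm := by
        intro x y
        obtain ⟨x, rfl⟩ := Ideal.Quotient.mk_surjective x
        obtain ⟨y, rfl⟩ := Ideal.Quotient.mk_surjective y
        rw [← map_mul, ← map_mul, Ideal.Quotient.eq]
        exact h.comm x y }
  rw [← Ideal.Quotient.eq]
  rcases subsingleton_or_nontrivial (A ⧸ M) with hs | hs
  · exact Subsingleton.elim _ _
  have : CharP (A ⧸ M) p := by
    have h0 : ((p : ℕ) : A ⧸ M) = 0 := by
      have := congrArg (Ideal.Quotient.mk M) (CharP.cast_eq_zero A p)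
      simpa only [map_natCast, map_zero] using this
    exact (CharP.charP_iff_prime_eq_zero (Fact.out : p.Prime)).2 h0
  have := geom_sum₂_eq_sub_pow_of_char p (Ideal.Quotient.mk M a) (Ideal.Quotient.mk M b)
  simpa only [map_sum, map_mul, map_pow, map_sub] using this

theorem pow_comm_mul (h : IsSmall D M) (u : A) {z v : A} (hz : z ∈ D * D) (hv : v ∈ D)
    (i : ℕ) : u ^ i * z * v = z * u ^ i * v := by
  induction i with
  | zero => simp
  | succ i ih =>
    have h1 : u * z * (u ^ i * v) = z * u * (u ^ i * v) := by
      rw [← sub_eq_zero, ← sub_mul]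
      exact h.M_mul_D_mul (h.comm_mem_M_mul_D u hz) (D.mul_mem_left _ hv)
    calc u ^ (i + 1) * z * v = u * (u ^ i * z * v) := by rw [pow_succ']; noncomm_ring
      _ = u * z * (u ^ i * v) := by rw [ih]; noncomm_ring
      _ = z * u ^ (i + 1) * v := by rw [h1, pow_succ']; noncomm_ring

/-- With u = y + z, telescoping gives u^p - y^p = ∑ u^i z y^(p-1-i). The factor z can be moved to
the front of each term, and since z kills M the remaining sum may be computed as in a commutative
ring, where it is (u - y)^(p-1) = z^(p-1). -/
theorem add_pow_prime (h : IsSmall D M) (hp : 3 ≤ p) {y z : A} (hy : y ∈ D) (hz : z ∈ D * D) :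
    (y + z) ^ p = y ^ p + z ^ p := by
  set u := y + z with hu
  have huD : u ∈ D := D.add_mem hy (h.sq_le hz)
  have htel : ∀ N : ℕ, u ^ N - y ^ N = ∑ i ∈ Finset.range N, u ^ i * z * y ^ (N - 1 - i) := by
    intro N
    induction N with
    | zero => simp
    | succ N ih =>
      rw [Finset.sum_range_succ]
      have : ∑ i ∈ Finset.range N, u ^ i * z * y ^ (N + 1 - 1 - i) =
          (u ^ N - y ^ N) * y := by
        rw [ih, Finset.sum_mul]
        refine Finset.sum_congr rfl fun i hi => ?_
        rw [Finset.mem_range] at hi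
        rw [mul_assoc _ (y ^ _) y, ← pow_succ]
        congr 2
        omega
      rw [this]
      simp only [add_tsub_cancel_right, Nat.sub_self, pow_zero, mul_one]
      have hz' : z = u - y := by rw [hu]; abel
      rw [hz', pow_succ, pow_succ]
      noncomm_ring
  have hterm : ∀ i ∈ Finset.range p,
      u ^ i * z * y ^ (p - 1 - i) = z * (u ^ i * y ^ (p - 1 - i)) := by
    intro i hi
    rw [Finset.mem_range] at hi
    rcases Nat.lt_or_ge i (p - 1) with hlt | hge
    · rw [← mul_assoc]
      exact h.pow_comm_mul u hz (h.pow_mem hy (by omega)) i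
    -- No factor y remains here to absorb the commutator; instead u^(p-1) lies in D², which is where
    -- p ≥ 3 enters.
    · have hi' : i = p - 1 := by omega
      obtain ⟨j, hj⟩ := Nat.exists_eq_add_of_le' (show 1 ≤ p - 1 by omega)
      rw [hi', Nat.sub_self, pow_zero, mul_one, mul_one]
      have hj2 : 2 ≤ j + 1 := by omega
      exact h.sq_comm (h.pow_mem_sq huD (hj ▸ hj2)) hz
  have hz1 : u - y = z := by rw [hu]; abel
  have h1 : u ^ p - y ^ p = z ^ p := by
    rw [htel p, Finset.sum_congr rfl hterm, ← Finset.mul_sum]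
    have := h.D_mul_M (h.sq_le hz) (h.geom_sum₂_sub_mem (p := p) u y)
    rw [mul_sub, sub_eq_zero] at this
    rw [this, hz1, ← pow_succ', Nat.sub_add_cancel (by omega)]
  rw [← h1]
  abel

/-- The `p ^ k`-th power is additive on `D + D²` as soon as `p ^ k ≥ 3`. -/
theorem add_pow_of_mem_sq (h : IsSmall D M) {k : ℕ} (hk : 3 ≤ p ^ k) {y z : A} (hy : y ∈ D)
    (hz : z ∈ D * D) : (y + z) ^ p ^ k = y ^ p ^ k + z ^ p ^ k := by
  have hp2 := (Fact.out : p.Prime).two_le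
  obtain ⟨k, rfl⟩ : ∃ l, k = l + 1 := Nat.exists_eq_succ_of_ne_zero (by rintro rfl; simp at hk)
  rcases hp2.eq_or_lt with hp | hp
  · subst hp
    have hk0 : k ≠ 0 := by rintro rfl; norm_num at hk
    -- For p = 2 the first squaring leaves an error [y, z] in M; it disappears at the next squaring,
    -- available because 2^k ≥ 3.
    have hν : (y + z) ^ 2 = y ^ 2 + z ^ 2 + (y * z - z * y) := by
      have h2 : (2 : A) = 0 := by exact_mod_cast CharP.cast_eq_zero A 2
      have : (y + z) ^ 2 = y ^ 2 + z ^ 2 + (y * z - z * y) + 2 * (z * y) := by noncomm_ring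
      rw [this, h2, zero_mul, add_zero]
    rw [pow_succ', pow_mul, pow_mul, pow_mul, hν,
      h.add_pow_of_sq (Ideal.add_mem _ (h.pow_mem_sq hy le_rfl) (h.pow_mem_sq (h.sq_le hz) le_rfl))
        (h.M_le (h.comm _ _)),
      h.add_pow_of_sq (h.pow_mem_sq hy le_rfl) (h.pow_mem_sq (h.sq_le hz) le_rfl),
      h.M_pow (h.comm _ _) (two_le_prime_pow hk0), add_zero]
  · rw [pow_succ', pow_mul, pow_mul, pow_mul, h.add_pow_prime hp hy hz,
      h.add_pow_of_sq (h.pow_mem_sq hy hp2) (h.pow_mem_sq (h.sq_le hz) hp2)]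

/-- On a product xy the power is x^q y^q, which lies in M D² = 0; on D² the power map is additive.
-/
theorem sq_pow_eq_zero (h : IsSmall D M) {k : ℕ} (hk : k ≠ 0) (hD : ∀ x ∈ D, x ^ p ^ k ∈ M)
    {z : A} (hz : z ∈ D * D) : z ^ p ^ k = 0 := by
  have : z ∈ D * D ∧ z ^ p ^ k = 0 := by
    refine sq_induction hz (fun x hx y hy => ⟨Ideal.mul_mem_mul hx hy, ?_⟩)
      (fun x y hx hy => ⟨Ideal.add_mem _ hx.1 hy.1, ?_⟩)
    · rw [h.mul_pow hx]
      exact h.M_mul_sq (hD x hx) (h.pow_mem_sq hy (two_le_prime_pow hk))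
    · rw [h.add_pow_of_sq hx.1 hy.1, hx.2, hy.2, add_zero]
  exact this.2

end IsSmall
end BaginskiInvariant

/-! ### The commutator ideal and the small ideal of a group algebra -/

namespace BaginskiInvariant

open MonoidAlgebra

section Ideals

/-- The two-sided ideal generated by the ring commutators. -/
def commIdeal (R : Type*) [Ring R] : Ideal R :=
  Ideal.span {r | ∃ y z s : R, r = (y * z - z * y) * s}

/-- `ker ε · J + J · ker ε · ker ε`, where `J` is the commutator ideal. -/
def smallIdeal {R F : Type*} [Ring R] [Ring F] (ε : R →+* F) : Ideal R :=
  RingHom.ker ε * commIdeal R ⊔ commIdeal R * RingHom.ker ε * RingHom.ker ε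

variable {R S F : Type*} [Ring R] [Ring S] [Ring F]

instance commIdeal_isTwoSided : (commIdeal R).IsTwoSided := by
  refine ⟨fun {a} b ha => ?_⟩
  refine Submodule.span_induction (p := fun a _ => a * b ∈ commIdeal R) ?_ ?_ ?_ ?_ ha
  · rintro _ ⟨y, z, s, rfl⟩
    rw [mul_assoc]
    exact Ideal.subset_span ⟨y, z, s * b, rfl⟩
  · simp
  · intro x y _ _ hx hy
    rw [add_mul]
    exact Ideal.add_mem _ hx hy
  · intro r x _ hx
    rw [smul_eq_mul, mul_assoc]
    exact Ideal.mul_mem_left _ _ hx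

theorem comm_mem_commIdeal (y z : R) : y * z - z * y ∈ commIdeal R :=
  Ideal.subset_span ⟨y, z, 1, by rw [mul_one]⟩

theorem commIdeal_le {I : Ideal R} (hI : ∀ {x : R} (a : R), x ∈ I → x * a ∈ I)
    (hc : ∀ y z : R, y * z - z * y ∈ I) : commIdeal R ≤ I := by
  refine Ideal.span_le.2 ?_
  rintro _ ⟨y, z, s, rfl⟩
  exact hI _ (hc y z)

theorem map_mem_commIdeal (f : R →+* S) {r : R} (hr : r ∈ commIdeal R) : f r ∈ commIdeal S := by
  refine commIdeal_le (I := (commIdeal S).comap f) (fun {x} a hx => ?_) (fun y z => ?_) hr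
  · exact Ideal.mul_mem_right _ _ hx
  · rw [Ideal.mem_comap, map_sub, map_mul, map_mul]
    exact comm_mem_commIdeal _ _

theorem exists_commIdeal_lift {f : R →+* S} (hf : Function.Surjective f) {m : S}
    (hm : m ∈ commIdeal S) : ∃ r ∈ commIdeal R, f r = m := by
  refine Submodule.span_induction (p := fun m _ => ∃ r ∈ commIdeal R, f r = m) ?_ ?_ ?_ ?_ hm
  · rintro _ ⟨y, z, s, rfl⟩
    obtain ⟨y, rfl⟩ := hf y
    obtain ⟨z, rfl⟩ := hf z
    obtain ⟨s, rfl⟩ := hf s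
    exact ⟨(y * z - z * y) * s, Ideal.subset_span ⟨y, z, s, rfl⟩, by simp⟩
  · exact ⟨0, Ideal.zero_mem _, map_zero f⟩
  · rintro _ _ _ _ ⟨r, hr, rfl⟩ ⟨s, hs, rfl⟩
    exact ⟨r + s, Ideal.add_mem _ hr hs, map_add f r s⟩
  · rintro a _ _ ⟨r, hr, rfl⟩
    obtain ⟨a, rfl⟩ := hf a
    exact ⟨a * r, Ideal.mul_mem_left _ _ hr, map_mul f a r⟩

theorem map_commIdeal_eq_zero (f : R →+* S) (hS : ∀ x y : S, x * y = y * x) {r : R}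
    (hr : r ∈ commIdeal R) : f r = 0 := by
  rw [← RingHom.mem_ker]
  refine commIdeal_le (fun {x} a hx => Ideal.mul_mem_right _ _ hx) (fun y z => ?_) hr
  rw [RingHom.mem_ker, map_sub, map_mul, map_mul, hS, sub_self]

theorem smallIdeal_le_comap (f : R →+* S) (ε : R →+* F) (ε' : S →+* F)
    (h : ∀ r, ε' (f r) = ε r) : smallIdeal ε ≤ (smallIdeal ε').comap f := by
  have hk : ∀ r ∈ RingHom.ker ε, f r ∈ RingHom.ker ε' := fun r hr => by
    rw [RingHom.mem_ker, h, RingHom.mem_ker.1 hr]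
  refine sup_le (Ideal.mul_le.2 fun x hx m hm => ?_) (Ideal.mul_le.2 fun z hz t ht => ?_)
  · rw [Ideal.mem_comap, map_mul]
    exact Ideal.mem_sup_left (Ideal.mul_mem_mul (hk x hx) (map_mem_commIdeal f hm))
  · rw [Ideal.mem_comap, map_mul]
    refine Ideal.mem_sup_right (Ideal.mul_mem_mul ?_ (hk t ht))
    refine Submodule.smul_induction_on hz (fun m hm s hs => ?_) (fun x y hx hy => ?_)
    · rw [smul_eq_mul, map_mul]
      exact Ideal.mul_mem_mul (map_mem_commIdeal f hm) (hk s hs)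
    · rw [map_add]
      exact Ideal.add_mem _ hx hy

instance smallIdeal_isTwoSided (ε : R →+* F) : (smallIdeal ε).IsTwoSided := by
  refine ⟨fun {a} b ha => ?_⟩
  obtain ⟨x, hx, y, hy, rfl⟩ := Submodule.mem_sup.1 ha
  rw [add_mul]
  exact Ideal.add_mem _ (Ideal.mem_sup_left (Ideal.mul_mem_right _ _ hx))
    (Ideal.mem_sup_right (Ideal.mul_mem_right _ _ hy))

theorem smallIdeal_le_commIdeal (ε : R →+* F) : smallIdeal ε ≤ commIdeal R := by
  refine sup_le (Ideal.mul_le.2 fun x _ m hm => Ideal.mul_mem_left _ _ hm)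
    (Ideal.mul_le.2 fun z hz t _ => Ideal.mul_mem_right _ _ ?_)
  exact Ideal.mul_le.2 (fun m hm x _ => Ideal.mul_mem_right _ _ hm) hz

variable {p : ℕ} [Fact p.Prime]

/-- Since the augmentation takes values in the prime field, each element differs from an integer,
hence central, multiple of 1 by an element of the kernel; commutators therefore only see the kernel
parts. -/
theorem commIdeal_le_ker_sq (ε : R →+* ZMod p) :
    commIdeal R ≤ RingHom.ker ε * RingHom.ker ε := by
  refine commIdeal_le (fun {x} a hx => Ideal.mul_mem_right _ _ hx) (fun y z => ?_)
  have hk : ∀ r : R, r - ((ε r).val : R) ∈ RingHom.ker ε := fun r => by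
    rw [RingHom.mem_ker, map_sub, map_natCast, ZMod.natCast_zmod_val, sub_self]
  have hy := hk y
  have hz := hk z
  have : y * z - z * y = (y - ((ε y).val : R)) * (z - ((ε z).val : R)) -
      (z - ((ε z).val : R)) * (y - ((ε y).val : R)) := by
    have h1 := Nat.cast_commute (ε y).val z
    have h2 := Nat.cast_commute (ε z).val y
    have h3 := Nat.cast_commute (ε y).val ((ε z).val : R)
    rw [commute_iff_eq] at h1 h2 h3
    simp only [sub_mul, mul_sub, h1, h2, h3]
    abel
  rw [this]
  exact Ideal.sub_mem _ (Ideal.mul_mem_mul hy hz) (Ideal.mul_mem_mul hz hy)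

theorem ker_sq_le_ker (ε : R →+* ZMod p) :
    RingHom.ker ε * RingHom.ker ε ≤ RingHom.ker ε :=
  Ideal.mul_le.2 fun _ _ _ hy => Ideal.mul_mem_left _ _ hy

theorem smallIdeal_le_ker_sq (ε : R →+* ZMod p) :
    smallIdeal ε ≤ RingHom.ker ε * RingHom.ker ε :=
  (smallIdeal_le_commIdeal ε).trans (commIdeal_le_ker_sq ε)

end Ideals

section GroupAlgebra

variable (p : ℕ) [Fact p.Prime] (G : Type*) [Group G]

/-- The augmentation of the group algebra over the field with `p` elements. -/
noncomputable def aug : MonoidAlgebra (ZMod p) G →+* ZMod p :=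
  (MonoidAlgebra.lift (ZMod p) (ZMod p) G (1 : G →* ZMod p)).toRingHom

variable {p G}

@[simp]
theorem aug_of (g : G) : aug p G (of (ZMod p) G g) = 1 := by
  simp [aug]

-- Scalars of `ZMod p` act as natural multiples, so closure under addition suffices.
@[elab_as_elim]
theorem algebra_induction {C : MonoidAlgebra (ZMod p) G → Prop} (x : MonoidAlgebra (ZMod p) G)
    (hof : ∀ g, C (of (ZMod p) G g)) (hzero : C 0) (hadd : ∀ x y, C x → C y → C (x + y)) :
    C x := by
  refine MonoidAlgebra.induction_on x hof hadd ?_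
  intro r f hf
  have : r • f = r.val • f := by
    rw [← Nat.cast_smul_eq_nsmul (ZMod p), ZMod.natCast_zmod_val]
  rw [this]
  generalize r.val = n
  induction n with
  | zero => simpa using hzero
  | succ n ih => rw [succ_nsmul]; exact hadd _ _ ih hf

/-- The elements `n - 1` with `n` in a normal subgroup containing the commutators generate an
additive group containing the commutator ideal, up to left translation. -/
theorem commIdeal_le_closure (N : Subgroup G) [N.Normal]
    (hN : ∀ g h : G, g⁻¹ * h⁻¹ * g * h ∈ N) {r : MonoidAlgebra (ZMod p) G}
    (hr : r ∈ commIdeal (MonoidAlgebra (ZMod p) G)) :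
    r ∈ AddSubgroup.closure {x : MonoidAlgebra (ZMod p) G |
      ∃ g : G, ∃ n ∈ N, x = of (ZMod p) G g * (of (ZMod p) G n - 1)} := by
  set T := AddSubgroup.closure {x : MonoidAlgebra (ZMod p) G |
      ∃ g : G, ∃ n ∈ N, x = of (ZMod p) G g * (of (ZMod p) G n - 1)} with hT
  have hleft : ∀ a x : MonoidAlgebra (ZMod p) G, x ∈ T → a * x ∈ T := by
    intro a x hx
    refine AddSubgroup.closure_induction (p := fun x _ => a * x ∈ T) ?_ ?_ ?_ ?_ hx
    · rintro _ ⟨g, n, hn, rfl⟩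
      refine algebra_induction a (fun h => ?_) ?_ (fun x y hx hy => ?_)
      · exact AddSubgroup.subset_closure ⟨h * g, n, hn, by rw [map_mul, mul_assoc]⟩
      · rw [zero_mul]; exact T.zero_mem
      · rw [add_mul]; exact T.add_mem hx hy
    · rw [mul_zero]; exact T.zero_mem
    · intro x y _ _ hx hy
      rw [mul_add]; exact T.add_mem hx hy
    · intro x _ hx
      rw [mul_neg]; exact T.neg_mem hx
  have hright : ∀ a x : MonoidAlgebra (ZMod p) G, x ∈ T → x * a ∈ T := by
    -- Right multiplication is handled by g(n - 1)h = gh(h⁻¹nh - 1), using normality.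
    intro a x hx
    refine AddSubgroup.closure_induction (p := fun x _ => x * a ∈ T) ?_ ?_ ?_ ?_ hx
    · rintro _ ⟨g, n, hn, rfl⟩
      refine algebra_induction a (fun h => ?_) ?_ (fun x y hx hy => ?_)
      · refine AddSubgroup.subset_closure ⟨g * h, h⁻¹ * n * h, ?_, ?_⟩
        · simpa using ‹N.Normal›.conj_mem n hn h⁻¹
        · rw [mul_sub, sub_mul, mul_sub, mul_one, mul_one, ← map_mul, ← map_mul, ← map_mul,
            ← map_mul]
          congr 2
          group
      · rw [mul_zero]; exact T.zero_mem
      · rw [mul_add]; exact T.add_mem hx hy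
    · rw [zero_mul]; exact T.zero_mem
    · intro x y _ _ hx hy
      rw [add_mul]; exact T.add_mem hx hy
    · intro x _ hx
      rw [neg_mul]; exact T.neg_mem hx
  let I : Ideal (MonoidAlgebra (ZMod p) G) :=
    { carrier := T
      zero_mem' := T.zero_mem
      add_mem' := T.add_mem
      smul_mem' := fun a x hx => hleft a x hx }
  refine commIdeal_le (I := I) (fun {x} a hx => hright a x hx) (fun y z => ?_) hr
  change y * z - z * y ∈ T
  refine algebra_induction y (fun g => ?_) ?_ (fun x y hx hy => ?_)
  · refine algebra_induction z (fun h => ?_) ?_ (fun x y hx hy => ?_)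
    · refine AddSubgroup.subset_closure ⟨h * g, g⁻¹ * h⁻¹ * g * h, hN g h, ?_⟩
      rw [mul_sub, mul_one, ← map_mul, ← map_mul, ← map_mul]
      congr 2
      group
    · simp
    · have : of (ZMod p) G g * (x + y) - (x + y) * of (ZMod p) G g =
        (of (ZMod p) G g * x - x * of (ZMod p) G g) +
          (of (ZMod p) G g * y - y * of (ZMod p) G g) := by noncomm_ring
      rw [this]
      exact T.add_mem hx hy
  · simp
  · have : (x + y) * z - z * (x + y) = (x * z - z * x) + (y * z - z * y) := by noncomm_ring
    rw [this]
    exact T.add_mem hx hy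

/-- A homomorphism from a normal subgroup `N` with abelian quotient into an elementary abelian
`p`-group, killing the double commutators `[n, h, h']`, extends to an additive map on the group
algebra which kills the small ideal. -/
theorem exists_addHom_smallIdeal (N : Subgroup G) [N.Normal]
    (hN : ∀ g h : G, g⁻¹ * h⁻¹ * g * h ∈ N) {W : Type*} [AddCommGroup W] [Module (ZMod p) W]
    (θ : N → W) (hmul : ∀ m n : N, θ (m * n) = θ m + θ n)
    (hθ : ∀ (n : G) (hn : n ∈ N) (h h' : G),
      θ ⟨(h * h')⁻¹ * n * (h * h'), by simpa using ‹N.Normal›.conj_mem n hn (h * h')⁻¹⟩ +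
        θ ⟨n, hn⟩ =
      θ ⟨h⁻¹ * n * h, by simpa using ‹N.Normal›.conj_mem n hn h⁻¹⟩ +
        θ ⟨h'⁻¹ * n * h', by simpa using ‹N.Normal›.conj_mem n hn h'⁻¹⟩) :
    ∃ l : MonoidAlgebra (ZMod p) G →+ W, (∀ r ∈ smallIdeal (aug p G), l r = 0) ∧
      ∀ n : N, l (of (ZMod p) G n - 1) = θ n := by
  have hs : ∀ g : G, ((g : G ⧸ N).out)⁻¹ * g ∈ N := fun g =>
    QuotientGroup.eq.1 (QuotientGroup.out_eq' (g : G ⧸ N))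
  -- A transversal of N splits each g as representative times an element of N; `v` is θ of the
  -- latter. Its linear extension `l` does not depend on the left factor: l(g(n - 1)) = θ(n).
  let v : G → W := fun g => θ ⟨((g : G ⧸ N).out)⁻¹ * g, hs g⟩
  have hv : ∀ g n : G, ∀ hn : n ∈ N, v (g * n) = v g + θ ⟨n, hn⟩ := by
    intro g n hn
    have h1 : ((g * n : G) : G ⧸ N) = (g : G ⧸ N) := QuotientGroup.mk_mul_of_mem g hn
    change θ _ = θ _ + θ _
    rw [← hmul]
    congr 1
    ext
    simp only [h1, Subgroup.coe_mul, mul_assoc]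
  let l : MonoidAlgebra (ZMod p) G →+ W :=
    { toFun := fun x => Finsupp.linearCombination (ZMod p) v x.coeff
      map_zero' := by simp
      map_add' := fun x y => by simp }
  have hlof : ∀ g, l (of (ZMod p) G g) = v g := by
    intro g
    change Finsupp.linearCombination (ZMod p) v (of (ZMod p) G g).coeff = v g
    simp [of_apply]
  have hl1 : ∀ g n : G, ∀ hn : n ∈ N,
      l (of (ZMod p) G g * (of (ZMod p) G n - 1)) = θ ⟨n, hn⟩ := by
    intro g n hn
    rw [mul_sub, mul_one, ← map_mul, map_sub, hlof, hlof, hv g n hn, add_sub_cancel_left]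
  -- This makes `l` vanish on DJ.
  have hJ : ∀ r ∈ commIdeal (MonoidAlgebra (ZMod p) G), ∀ x, l (x * r) = aug p G x • l r := by
    intro r hr x
    refine AddSubgroup.closure_induction (p := fun r _ => l (x * r) = aug p G x • l r)
      ?_ ?_ ?_ ?_ (commIdeal_le_closure N hN hr)
    · rintro _ ⟨g, n, hn, rfl⟩
      rw [hl1 g n hn]
      refine algebra_induction x (fun h => ?_) ?_ (fun x y hx hy => ?_)
      · rw [← mul_assoc, ← map_mul, hl1 _ n hn, aug_of, one_smul]
      · simp
      · rw [add_mul, map_add, hx, hy, map_add, add_smul]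
    · simp
    · intro r s _ _ hr hs
      rw [mul_add, map_add, hr, hs, map_add, smul_add]
    · intro r _ hr
      rw [mul_neg, map_neg, hr, map_neg, smul_neg]
  have hJr : ∀ g n h : G, ∀ hn : n ∈ N,
      l (of (ZMod p) G g * (of (ZMod p) G n - 1) * of (ZMod p) G h) =
        θ ⟨h⁻¹ * n * h, by simpa using ‹N.Normal›.conj_mem n hn h⁻¹⟩ := by
    intro g n h hn
    rw [← hl1 (g * h)]
    congr 1
    rw [mul_sub, sub_mul, mul_sub, mul_one, mul_one, ← map_mul, ← map_mul, ← map_mul,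
      ← map_mul]
    congr 2
    group
  -- Linearized form of `hθ`; for s and t in the augmentation ideal it gives l(rst) = 0, so `l`
  -- vanishes on JDD.
  have hJ2 : ∀ r ∈ commIdeal (MonoidAlgebra (ZMod p) G), ∀ s t,
      l (r * s * t) + aug p G s • aug p G t • l r = 
        aug p G t • l (r * s) + aug p G s • l (r * t) := by
    intro r hr s t
    refine AddSubgroup.closure_induction (p := fun r _ => l (r * s * t) +
      aug p G s • aug p G t • l r = aug p G t • l (r * s) + aug p G s • l (r * t))
      ?_ ?_ ?_ ?_ (commIdeal_le_closure N hN hr)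
    · rintro _ ⟨g, n, hn, rfl⟩
      refine algebra_induction s (fun h => ?_) ?_ (fun x y hx hy => ?_)
      · refine algebra_induction t (fun h' => ?_) ?_ (fun x y hx hy => ?_)
        · rw [mul_assoc _ (of (ZMod p) G h), ← map_mul, hJr g n _ hn, hJr g n _ hn, hJr g n _ hn,
            hl1 g n hn, aug_of, aug_of, one_smul, one_smul, one_smul, one_smul]
          exact hθ n hn h h'
        · simp
        · have := congrArg₂ (· + ·) hx hy
          simp only [mul_add, map_add, add_smul, aug_of, one_smul] at this ⊢
          rw [add_add_add_comm, this]
          abel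
      · simp
      · have := congrArg₂ (· + ·) hx hy
        simp only [mul_add, add_mul, map_add, add_smul, smul_add] at this ⊢
        rw [add_add_add_comm, this]
        abel
    · simp
    · intro r r' _ _ hx hy
      have := congrArg₂ (· + ·) hx hy
      simp only [add_mul, map_add, smul_add] at this ⊢
      rw [add_add_add_comm, this]
      abel
    · intro r _ hx
      have := congrArg Neg.neg hx
      simp only [neg_mul, map_neg, smul_neg] at this ⊢
      rw [← neg_add, this]
      abel
  refine ⟨l, fun r hr => ?_, fun n => ?_⟩
  · obtain ⟨x, hx, y, hy, rfl⟩ := Submodule.mem_sup.1 hr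
    have h1 : l x = 0 := by
      refine Submodule.smul_induction_on hx (fun a ha m hm => ?_) (fun a b ha hb => ?_)
      · rw [smul_eq_mul, hJ m hm, RingHom.mem_ker.1 ha, zero_smul]
      · rw [map_add, ha, hb, add_zero]
    have h2 : l y = 0 := by
      refine Submodule.smul_induction_on hy (fun a ha t ht => ?_) (fun a b ha hb => ?_)
      · rw [smul_eq_mul]
        refine Submodule.smul_induction_on ha (fun m hm s hs => ?_) (fun a b ha hb => ?_)
        · have := hJ2 m hm s t
          rw [RingHom.mem_ker.1 ht, RingHom.mem_ker.1 hs] at this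
          simpa using this
        · rw [add_mul, map_add, ha, hb, add_zero]
      · rw [map_add, ha, hb, add_zero]
    rw [map_add, h1, h2, add_zero]
  · have := hl1 1 n n.2
    rwa [map_one, one_mul] at this

end GroupAlgebra

end BaginskiInvariant

/-! ### Models: the kernel of the group in A, and the invariants visible in A -/

namespace BaginskiInvariant

open MonoidAlgebra
open scoped commutatorElement

section LowerCentral

variable {G : Type*} [Group G]

theorem comm_mem_gam_two (g h : G) : g⁻¹ * h⁻¹ * g * h ∈ gam 2 G := by
  have h1 : ⁅g⁻¹, h⁻¹⁆ ∈ ⁅(⊤ : Subgroup G), ⊤⁆ :=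
    Subgroup.commutator_mem_commutator (Subgroup.mem_top _) (Subgroup.mem_top _)
  rwa [commutatorElement_def, inv_inv, inv_inv] at h1

theorem comm_mem_gam_succ {i : ℕ} (hi : i ≠ 0) {n : G} (hn : n ∈ gam i G) (h : G) :
    n⁻¹ * (h⁻¹ * n * h) ∈ gam (i + 1) G := by
  obtain ⟨i, rfl⟩ := Nat.exists_eq_succ_of_ne_zero hi
  have h1 : ⁅n⁻¹, h⁻¹⁆ ∈ ⁅gam (i + 1) G, ⊤⁆ :=
    Subgroup.commutator_mem_commutator (Subgroup.inv_mem _ hn) (Subgroup.mem_top _)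
  rw [commutatorElement_def, inv_inv, inv_inv] at h1
  have h2 : n⁻¹ * (h⁻¹ * n * h) = n⁻¹ * h⁻¹ * n * h := by group
  rw [h2]
  exact h1

/-- The three subgroups lemma, applied in the quotient by γ₄. -/
theorem commutator_gam_two_le : ⁅gam 2 G, gam 2 G⁆ ≤ gam 4 G := by
  have hmap : ∀ H : Subgroup G, H ≤ gam 4 G →
      H.map (QuotientGroup.mk' (gam 4 G)) = ⊥ := fun H hH => by
    rw [Subgroup.map_eq_bot_iff, QuotientGroup.ker_mk']
    exact hH
  have h4 : ⁅⁅gam 2 G, ⊤⁆, (⊤ : Subgroup G)⁆ ≤ gam 4 G := le_of_eq rfl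
  have hbot := hmap _ h4
  rw [Subgroup.map_commutator, Subgroup.map_commutator] at hbot
  have hbot' := hbot
  rw [Subgroup.commutator_comm ((gam 2 G).map _)] at hbot'
  have := Subgroup.commutator_commutator_eq_bot_of_rotate hbot' hbot
  rw [← Subgroup.map_commutator, ← Subgroup.map_commutator, Subgroup.map_eq_bot_iff,
    QuotientGroup.ker_mk'] at this
  exact this

theorem kernelSubgroup_le (p : ℕ) : kernelSubgroup p G ≤ gam 2 G := by
  refine sup_le ((Subgroup.closure_le _).2 ?_) ?_
  · rintro _ ⟨x, hx, rfl⟩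
    exact Subgroup.pow_mem _ hx p
  · exact Subgroup.lowerCentralSeries_antitone _ (by norm_num)

end LowerCentral

section Model

variable {p : ℕ} [Fact p.Prime] {G : Type*} [Group G] {A : Type*} [Ring A]

/-- The group homomorphism into the multiplicative monoid of `A` underlying a ring homomorphism
from the group algebra. -/
noncomputable def rho (π : MonoidAlgebra (ZMod p) G →+* A) : G →* A :=
  (π : MonoidAlgebra (ZMod p) G →* A).comp (of (ZMod p) G)

theorem rho_apply (π : MonoidAlgebra (ZMod p) G →+* A) (g : G) :
    rho π g = π (of (ZMod p) G g) := rfl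

/-- `π` presents the augmented ring `A` as the quotient of the group algebra by its small ideal. -/
structure IsModel (ε : A →+* ZMod p) (π : MonoidAlgebra (ZMod p) G →+* A) : Prop where
  surj : Function.Surjective π
  ker : ∀ r, π r = 0 ↔ r ∈ smallIdeal (aug p G)
  aug : ∀ r, ε (π r) = aug p G r

/-- The canonical map to the group algebra of the abelianization. -/
noncomputable def abMap (p : ℕ) (G : Type*) [Group G] :
    MonoidAlgebra (ZMod p) G →+* MonoidAlgebra (ZMod p) (G ⧸ gam 2 G) :=
  MonoidAlgebra.mapDomainRingHom (ZMod p) (QuotientGroup.mk' (gam 2 G))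

theorem abMap_of (g : G) :
    abMap p G (of (ZMod p) G g) = of (ZMod p) (G ⧸ gam 2 G) (g : G ⧸ gam 2 G) := by
  simp [abMap]

theorem charP_monoidAlgebra (Q : Type*) [Group Q] : CharP (MonoidAlgebra (ZMod p) Q) p :=
  charP_of_injective_algebraMap (algebraMap (ZMod p) (MonoidAlgebra (ZMod p) Q)).injective p

theorem quotient_gam_two_comm (x y : G ⧸ gam 2 G) : x * y = y * x := by
  obtain ⟨x, rfl⟩ := QuotientGroup.mk_surjective x
  obtain ⟨y, rfl⟩ := QuotientGroup.mk_surjective y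
  rw [← QuotientGroup.mk_mul, ← QuotientGroup.mk_mul, QuotientGroup.eq]
  simpa [mul_assoc] using comm_mem_gam_two y x

theorem abAlgebra_comm (x y : MonoidAlgebra (ZMod p) (G ⧸ gam 2 G)) : x * y = y * x := by
  refine algebra_induction x (fun g => ?_) ?_ (fun a b ha hb => ?_)
  · refine algebra_induction y (fun h => ?_) ?_ (fun a b ha hb => ?_)
    · rw [← map_mul, ← map_mul, quotient_gam_two_comm]
    · simp
    · rw [mul_add, add_mul, ha, hb]
  · simp
  · rw [mul_add, add_mul, ha, hb]

theorem abMap_surjective : Function.Surjective (abMap p G) := by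
  intro y
  refine algebra_induction y (fun g => ?_) ⟨0, map_zero _⟩ ?_
  · obtain ⟨g, rfl⟩ := QuotientGroup.mk_surjective g
    exact ⟨_, abMap_of g⟩
  · rintro _ _ ⟨x, rfl⟩ ⟨y, rfl⟩
    exact ⟨x + y, map_add _ x y⟩

/-- A ring homomorphism with commuting values factors through the group algebra of the
abelianization. -/
theorem map_eq_zero_of_abMap_eq_zero {Q : Type*} [Ring Q] [Algebra (ZMod p) Q]
    (f : MonoidAlgebra (ZMod p) G →+* Q) (hc : ∀ x y, f x * f y = f y * f x)
    {r : MonoidAlgebra (ZMod p) G} (hr : abMap p G r = 0) : f r = 0 := by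
  have hf : gam 2 G ≤ (rho f).ker := by
    refine Subgroup.commutator_le.2 fun g _ h _ => ?_
    rw [MonoidHom.mem_ker, commutatorElement_def, map_mul, map_mul, map_mul, rho_apply f g,
      rho_apply f h, hc, ← rho_apply, ← rho_apply, mul_assoc (rho f h), ← map_mul,
      mul_inv_cancel, map_one, mul_one, ← map_mul, mul_inv_cancel, map_one]
  let F : MonoidAlgebra (ZMod p) (G ⧸ gam 2 G) →ₐ[ZMod p] Q :=
    MonoidAlgebra.lift (ZMod p) Q (G ⧸ gam 2 G) (QuotientGroup.lift (gam 2 G) (rho f) hf)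
  have hF : ∀ r, F (abMap p G r) = f r := by
    intro r
    refine algebra_induction r (fun g => ?_) (by simp) (fun x y hx hy => ?_)
    · rw [abMap_of, MonoidAlgebra.lift_of]
      rfl
    · rw [map_add, map_add, hx, hy, map_add]
  rw [← hF r, hr, map_zero]

/-- The kernel of the map to the group algebra of the abelianization is the commutator ideal. -/
theorem abMap_eq_zero_iff (r : MonoidAlgebra (ZMod p) G) :
    abMap p G r = 0 ↔ r ∈ commIdeal (MonoidAlgebra (ZMod p) G) := by
  refine ⟨fun h => ?_, fun h => map_commIdeal_eq_zero _ abAlgebra_comm h⟩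
  rw [← Ideal.Quotient.eq_zero_iff_mem]
  refine map_eq_zero_of_abMap_eq_zero (Ideal.Quotient.mk (commIdeal _)) (fun x y => ?_) h
  rw [← map_mul, ← map_mul]
  exact Ideal.Quotient.eq.2 (comm_mem_commIdeal _ _)

/-- Frobenius is additive on the commutative group algebra of the abelianization, and group elements
become 1. -/
theorem abMap_pow (k : ℕ) (hk : ∀ g : G, g ^ p ^ k ∈ gam 2 G) (r : MonoidAlgebra (ZMod p) G) :
    abMap p G r ^ p ^ k = algebraMap (ZMod p) _ (aug p G r) := by
  have := charP_monoidAlgebra (p := p) (G ⧸ gam 2 G)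
  have hp := (Fact.out : p.Prime).ne_zero
  refine algebra_induction r (fun g => ?_) (by simp [hp]) (fun x y hx hy => ?_)
  · rw [abMap_of, ← map_pow, ← QuotientGroup.mk_pow, (QuotientGroup.eq_one_iff _).2 (hk g),
      map_one, aug_of, map_one]
  · rw [map_add, add_pow_char_pow_of_commute _ _ (abAlgebra_comm _ _), hx, hy, map_add, map_add]

/-- An element of the group whose difference to `1` lies in the small ideal lies in
`γ₂(G)^p γ₄(G)`. -/
theorem mem_kernelSubgroup_of_sub_one_mem {g : G}
    (hg : of (ZMod p) G g - 1 ∈ smallIdeal (aug p G)) : g ∈ kernelSubgroup p G := by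
  have hg2 : g ∈ gam 2 G := by
    have := (abMap_eq_zero_iff _).2 (smallIdeal_le_commIdeal _ hg)
    rw [map_sub, map_one, abMap_of, sub_eq_zero, ← map_one (of (ZMod p) (G ⧸ gam 2 G))] at this
    exact (QuotientGroup.eq_one_iff _).1 (MonoidAlgebra.of_injective this)
  let N := gam 2 G
  let K := (kernelSubgroup p G).subgroupOf N
  have hK4 : ∀ x ∈ gam 4 G, x ∈ kernelSubgroup p G := fun x hx => Subgroup.mem_sup_right hx
  let : CommGroup (N ⧸ K) :=
    { QuotientGroup.Quotient.group K with
      mul_comm := by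
        intro x y
        obtain ⟨x, rfl⟩ := QuotientGroup.mk_surjective x
        obtain ⟨y, rfl⟩ := QuotientGroup.mk_surjective y
        refine QuotientGroup.eq.2 ?_
        rw [Subgroup.mem_subgroupOf]
        refine hK4 _ (commutator_gam_two_le ?_)
        have := Subgroup.commutator_mem_commutator (Subgroup.inv_mem _ y.2)
          (Subgroup.inv_mem _ x.2)
        rw [commutatorElement_def, inv_inv, inv_inv] at this
        simpa [mul_assoc] using this }
  let θ : N → Additive (N ⧸ K) := fun n => Additive.ofMul (n : N ⧸ K)
  have hmul : ∀ m n : N, θ (m * n) = θ m + θ n := fun m n => rfl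
  have hpw : ∀ x : Additive (N ⧸ K), p • x = 0 := by
    intro x
    obtain ⟨n, hn⟩ := QuotientGroup.mk_surjective x.toMul
    have : x = θ n := by
      change x = Additive.ofMul (n : N ⧸ K)
      rw [hn]; rfl
    rw [this]
    change Additive.ofMul (((n ^ p : N)) : N ⧸ K) = 0
    rw [ofMul_eq_zero]
    refine (QuotientGroup.eq_one_iff _).2 ?_
    exact Subgroup.mem_sup_left (Subgroup.subset_closure ⟨n, n.2, by simp⟩)
  let := AddCommGroup.zmodModule hpw
  have hconj : ∀ n ∈ gam 2 G, ∀ h : G, h⁻¹ * n * h ∈ gam 2 G := fun n hn h => by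
    simpa using (gam_normal 2 G).conj_mem n hn h⁻¹
  have h32 : gam 3 G ≤ gam 2 G := Subgroup.lowerCentralSeries_antitone _ (by norm_num)
  have hθ : ∀ (n : G) (hn : n ∈ gam 2 G) (h h' : G),
      θ ⟨(h * h')⁻¹ * n * (h * h'), hconj n hn _⟩ + θ ⟨n, hn⟩ =
        θ ⟨h⁻¹ * n * h, hconj n hn _⟩ + θ ⟨h'⁻¹ * n * h', hconj n hn _⟩ := by
    intro n hn h h'
    have hc := comm_mem_gam_succ (by norm_num) hn h
    -- Here n^h = nc with c in γ₃, and n^(hh') = n^(h') c^(h') where c^(h') ≡ c modulo γ₄; this is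
    -- the required additivity.
    set c := n⁻¹ * (h⁻¹ * n * h) with hcdef
    have e1 : (⟨h⁻¹ * n * h, hconj n hn _⟩ : N) = ⟨n, hn⟩ * ⟨c, h32 hc⟩ := by
      ext
      simp [hcdef]
    have e2 : (⟨(h * h')⁻¹ * n * (h * h'), hconj n hn _⟩ : N) =
        ⟨h'⁻¹ * n * h', hconj n hn _⟩ * ⟨h'⁻¹ * c * h', hconj c (h32 hc) _⟩ := by
      ext
      simp only [hcdef, Subgroup.coe_mul]
      group
    have e3 : θ ⟨h'⁻¹ * c * h', hconj c (h32 hc) _⟩ = θ ⟨c, h32 hc⟩ := by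
      refine congrArg Additive.ofMul ?_
      refine Eq.symm (QuotientGroup.eq.2 ?_)
      rw [Subgroup.mem_subgroupOf]
      exact hK4 _ (comm_mem_gam_succ (by norm_num) hc h')
    rw [e1, e2, hmul, hmul, e3]
    abel
  obtain ⟨l, hl, hl'⟩ := exists_addHom_smallIdeal (p := p) N comm_mem_gam_two θ hmul hθ
  have := hl' ⟨g, hg2⟩
  rw [hl _ hg] at this
  have h1 : ((⟨g, hg2⟩ : N) : N ⧸ K) = 1 := Additive.ofMul.injective this.symm
  exact (QuotientGroup.eq_one_iff (⟨g, hg2⟩ : N)).1 h1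

namespace IsModel

variable {ε : A →+* ZMod p} {π : MonoidAlgebra (ZMod p) G →+* A}

theorem isSmall (h : IsModel ε π) : IsSmall (RingHom.ker ε) (commIdeal A) where
  right_D a hx := Ideal.mul_mem_right _ _ hx
  right_M a hx := Ideal.mul_mem_right _ _ hx
  M_le := commIdeal_le_ker_sq ε
  comm := comm_mem_commIdeal
  D_mul_M := by
    intro x m hx hm
    obtain ⟨x, rfl⟩ := h.surj x
    obtain ⟨m, hm', rfl⟩ := exists_commIdeal_lift h.surj hm
    rw [← map_mul, h.ker]
    rw [RingHom.mem_ker, h.aug] at hx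
    exact Ideal.mem_sup_left (Ideal.mul_mem_mul hx hm')
  M_mul_D_mul_D := by
    intro m x y hm hx hy
    obtain ⟨x, rfl⟩ := h.surj x
    obtain ⟨y, rfl⟩ := h.surj y
    obtain ⟨m, hm', rfl⟩ := exists_commIdeal_lift h.surj hm
    rw [← map_mul, ← map_mul, h.ker]
    rw [RingHom.mem_ker, h.aug] at hx hy
    exact Ideal.mem_sup_right (Ideal.mul_mem_mul (Ideal.mul_mem_mul hm' hx) hy)

theorem charP (_ : IsModel ε π) : CharP A p := by
  have : Nontrivial A := ε.domain_nontrivial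
  have := charP_monoidAlgebra (p := p) G
  refine (CharP.charP_iff_prime_eq_zero (Fact.out : p.Prime)).2 ?_
  rw [← map_natCast π, CharP.cast_eq_zero, map_zero]

theorem eps_rho (h : IsModel ε π) (g : G) : ε (rho π g) = 1 := by
  rw [rho_apply, h.aug, aug_of]

theorem rho_sub_one_mem (h : IsModel ε π) (g : G) : rho π g - 1 ∈ RingHom.ker ε := by
  rw [RingHom.mem_ker, map_sub, h.eps_rho, map_one, sub_self]

theorem map_mem_commIdeal_iff (h : IsModel ε π) (r : MonoidAlgebra (ZMod p) G) :
    π r ∈ commIdeal A ↔ abMap p G r = 0 := by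
  rw [abMap_eq_zero_iff]
  refine ⟨fun hr => ?_, map_mem_commIdeal π⟩
  obtain ⟨s, hs, hrs⟩ := exists_commIdeal_lift h.surj hr
  have h1 : r - s ∈ smallIdeal (BaginskiInvariant.aug p G) := by
    rw [← h.ker, map_sub, hrs, sub_self]
  have := Ideal.add_mem _ (smallIdeal_le_commIdeal _ h1) hs
  rwa [sub_add_cancel] at this

theorem rho_sub_one_mem_commIdeal_iff (h : IsModel ε π) (g : G) :
    rho π g - 1 ∈ commIdeal A ↔ g ∈ gam 2 G := by
  rw [rho_apply, ← map_one π, ← map_sub, h.map_mem_commIdeal_iff, map_sub, map_one, abMap_of,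
    sub_eq_zero, ← map_one (of (ZMod p) (G ⧸ gam 2 G)), MonoidAlgebra.of_injective.eq_iff,
    QuotientGroup.eq_one_iff]

theorem rho_mul_inv (g : G) : rho π g * rho π g⁻¹ = 1 := by
  rw [← map_mul, mul_inv_cancel, map_one]

theorem rho_inv_mul (g : G) : rho π g⁻¹ * rho π g = 1 := by
  rw [← map_mul, inv_mul_cancel, map_one]

theorem mul_eq_self (h : IsModel ε π) (g : G) {m : A} (hm : m ∈ commIdeal A) :
    rho π g * m = m := by
  have := h.isSmall.D_mul_M (h.rho_sub_one_mem g) hm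
  rwa [sub_mul, one_mul, sub_eq_zero] at this

theorem rho_commutator (g k : G) :
    rho π ⁅g, k⁆ = 1 + (rho π g * rho π k - rho π k * rho π g) * rho π (g⁻¹ * k⁻¹) := by
  rw [sub_mul, ← map_mul, ← map_mul, ← map_mul, ← map_mul, commutatorElement_def]
  have : k * g * (g⁻¹ * k⁻¹) = 1 := by group
  rw [this, map_one, mul_assoc (g * k)]
  abel

/-- One direction is the additive functional on the group algebra. Conversely n - 1 lies in M for n
in γ₂, so (n - 1)^p = 0 gives n^p = 1; and γ₄ dies because each further commutator multiplies n - 1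
by an element of D on the right, while MDD = 0. -/
theorem rho_eq_one_iff (h : IsModel ε π) (g : G) :
    rho π g = 1 ↔ g ∈ kernelSubgroup p G := by
  refine ⟨fun hg => mem_kernelSubgroup_of_sub_one_mem (p := p) ?_, fun hg => ?_⟩
  · rw [← h.ker, map_sub, ← rho_apply, hg, map_one, sub_self]
  have := h.charP
  suffices kernelSubgroup p G ≤ (rho π).ker from this hg
  refine sup_le ((Subgroup.closure_le _).2 ?_) ?_
  · rintro _ ⟨n, hn, rfl⟩
    have h1 := (h.rho_sub_one_mem_commIdeal_iff n).2 hn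
    have h2 := h.isSmall.M_pow h1 (Fact.out : p.Prime).two_le
    rw [sub_pow_char_of_commute _ (Commute.one_right _), one_pow, sub_eq_zero] at h2
    change rho π (n ^ p) = 1
    rw [map_pow, h2]
  -- For n in γ₃ the element n - 1 lies in MD up to units, hence annihilates D from the left.
  · have h3 : ∀ n ∈ gam 3 G, ∀ v ∈ RingHom.ker ε, (rho π n - 1) * v = 0 := by
      intro n hn v hv
      refine Subgroup.closure_induction (p := fun n _ => (rho π n - 1) * v = 0)
        ?_ ?_ ?_ ?_ hn
      · rintro _ ⟨g, hg, k, -, rfl⟩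
        rw [rho_commutator, add_sub_cancel_left]
        have hgM := (h.rho_sub_one_mem_commIdeal_iff g).2 hg
        have e : rho π g * rho π k - rho π k * rho π g =
            (rho π g - 1) * (rho π k - 1) - (rho π k - 1) * (rho π g - 1) := by noncomm_ring
        rw [e, h.isSmall.D_mul_M (h.rho_sub_one_mem k) hgM, sub_zero, mul_assoc]
        exact h.isSmall.M_mul_D_mul_D hgM (h.rho_sub_one_mem k) (Ideal.mul_mem_left _ _ hv)
      · simp
      · intro x y _ _ hx hy
        have e : (rho π (x * y) - 1) * v = rho π x * ((rho π y - 1) * v) + (rho π x - 1) * v := by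
          rw [map_mul]; noncomm_ring
        rw [e, hx, hy, mul_zero, add_zero]
      · intro x _ hx
        have e : (rho π x⁻¹ - 1) * v = -(rho π x⁻¹ * ((rho π x - 1) * v)) := by
          have := rho_inv_mul (π := π) x
          calc (rho π x⁻¹ - 1) * v = (rho π x⁻¹ - rho π x⁻¹ * rho π x) * v := by rw [this]
            _ = _ := by noncomm_ring
        rw [e, hx, mul_zero, neg_zero]
    refine (Subgroup.closure_le _).2 ?_
    rintro _ ⟨g, hg, k, -, rfl⟩
    change rho π ⁅g, k⁆ = 1
    have hgM := (h.rho_sub_one_mem_commIdeal_iff g).2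
      (Subgroup.lowerCentralSeries_antitone _ (show (1 : ℕ) ≤ 2 by norm_num) hg)
    have e : rho π g * rho π k - rho π k * rho π g =
        (rho π g - 1) * (rho π k - 1) - (rho π k - 1) * (rho π g - 1) := by noncomm_ring
    rw [rho_commutator, e, h.isSmall.D_mul_M (h.rho_sub_one_mem k) hgM,
      h3 g hg _ (h.rho_sub_one_mem k), sub_zero, zero_mul, add_zero]

/-- Every element of the commutator ideal is of the form `n - 1` with `n ∈ γ₂(G)`. -/
theorem exists_rho_eq (h : IsModel ε π) {m : A} (hm : m ∈ commIdeal A) :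
    ∃ n ∈ gam 2 G, rho π n = 1 + m := by
  obtain ⟨r, hr, rfl⟩ := exists_commIdeal_lift h.surj hm
  refine AddSubgroup.closure_induction (p := fun r _ => ∃ n ∈ gam 2 G, rho π n = 1 + π r)
    ?_ ?_ ?_ ?_ (commIdeal_le_closure (gam 2 G) comm_mem_gam_two hr)
  · rintro _ ⟨g, n, hn, rfl⟩
    refine ⟨n, hn, ?_⟩
    rw [map_mul, map_sub, map_one, ← rho_apply, ← rho_apply,
      h.mul_eq_self g ((h.rho_sub_one_mem_commIdeal_iff n).2 hn)]
    abel
  · exact ⟨1, Subgroup.one_mem _, by simp⟩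
  · rintro r s _ _ ⟨m, hm, hmr⟩ ⟨n, hn, hns⟩
    refine ⟨m * n, Subgroup.mul_mem _ hm hn, ?_⟩
    have h1 := h.isSmall.M_mul_M ((h.rho_sub_one_mem_commIdeal_iff m).2 hm)
      ((h.rho_sub_one_mem_commIdeal_iff n).2 hn)
    rw [hmr, hns, add_sub_cancel_left, add_sub_cancel_left] at h1
    rw [map_mul, hmr, hns, map_add, add_mul, mul_add, mul_add, h1]
    simp only [one_mul, mul_one, add_zero]
    abel
  · rintro r _ ⟨n, hn, hnr⟩
    refine ⟨n⁻¹, Subgroup.inv_mem _ hn, ?_⟩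
    have h1 := h.mul_eq_self n⁻¹ ((h.rho_sub_one_mem_commIdeal_iff n).2 hn)
    rw [mul_sub, rho_inv_mul, hnr, mul_one, add_sub_cancel_left] at h1
    rw [map_neg, ← h1]
    abel

/-- Shows that the exponent of the abelianization can be read off from A. -/
theorem pow_mem_iff (h : IsModel ε π) (k : ℕ) :
    (∀ g : G, g ^ p ^ k ∈ gam 2 G) ↔ ∀ x ∈ RingHom.ker ε, x ^ p ^ k ∈ commIdeal A := by
  have := h.charP
  constructor
  · intro hk x hx
    obtain ⟨r, rfl⟩ := h.surj x
    rw [RingHom.mem_ker, h.aug] at hx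
    rw [← map_pow, h.map_mem_commIdeal_iff, map_pow, abMap_pow k hk, hx, map_zero]
  · intro hk g
    have := hk _ (h.rho_sub_one_mem g)
    rw [sub_pow_char_pow_of_commute _ _ (Commute.one_right _), one_pow, ← map_pow] at this
    exact (h.rho_sub_one_mem_commIdeal_iff _).1 this

/-- The augmentation ideal is additively generated by the elements `g - 1`. -/
theorem ker_le_closure (h : IsModel ε π) {x : A} (hx : x ∈ RingHom.ker ε) :
    x ∈ AddSubgroup.closure (Set.range fun g => rho π g - 1) := by
  obtain ⟨r, rfl⟩ := h.surj x
  rw [RingHom.mem_ker, h.aug] at hx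
  have := h.charP
  have key : ∀ r : MonoidAlgebra (ZMod p) G, π r - ((BaginskiInvariant.aug p G r).val : A) ∈
      AddSubgroup.closure (Set.range fun g => rho π g - 1) := by
    intro r
    have hcast : ∀ a b : ZMod p, (((a + b).val : ℕ) : A) = (a.val : A) + (b.val : A) := by
      intro a b
      rw [← Nat.cast_add]
      refine (CharP.natCast_eq_natCast A p).2 ?_
      rw [ZMod.val_add]
      exact Nat.mod_modEq _ _
    refine algebra_induction r (fun g => ?_) ?_ (fun x y hx hy => ?_)
    · refine AddSubgroup.subset_closure ⟨g, ?_⟩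
      have : Fact (1 < p) := ⟨(Fact.out : p.Prime).one_lt⟩
      change rho π g - 1 = π (of (ZMod p) G g) - _
      rw [aug_of, ZMod.val_one, Nat.cast_one, rho_apply]
    · simp
    · rw [map_add, map_add, hcast, add_sub_add_comm]
      exact AddSubgroup.add_mem _ hx hy
  have h1 := key r
  rwa [hx, ZMod.val_zero, Nat.cast_zero, sub_zero] at h1

/-- A/M is the group algebra of the abelianization, so A determines the order of the latter. -/
theorem card_quotient_commIdeal [Finite G] (h : IsModel ε π) :
    Nat.card (A ⧸ commIdeal A) = p ^ Nat.card (G ⧸ gam 2 G) := by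
  let f : MonoidAlgebra (ZMod p) G →+* A ⧸ commIdeal A := (Ideal.Quotient.mk _).comp π
  have hf : Function.Surjective f := Ideal.Quotient.mk_surjective.comp h.surj
  have hker : RingHom.ker f = RingHom.ker (abMap p G) := by
    ext r
    rw [RingHom.mem_ker, RingHom.mem_ker, ← h.map_mem_commIdeal_iff]
    exact Ideal.Quotient.eq_zero_iff_mem
  have e1 := Nat.card_congr (RingHom.quotientKerEquivOfSurjective hf).toEquiv
  have e2 := Nat.card_congr
    (RingHom.quotientKerEquivOfSurjective (abMap_surjective (p := p) (G := G))).toEquiv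
  rw [← e1, hker, e2, Nat.card_congr MonoidAlgebra.coeffEquiv,
    Nat.card_congr Finsupp.equivFunOnFinite, Nat.card_fun, Nat.card_zmod]

/-- As M² = 0, n ↦ n - 1 turns multiplication in γ₂ into addition in M; it is onto with kernel γ₂^p
γ₄. -/
theorem card_quotient_kernelSubgroup (h : IsModel ε π) :
    Nat.card (G ⧸ kernelSubgroup p G) =
      Nat.card (commIdeal A) * Nat.card (G ⧸ gam 2 G) := by
  have h1 := Subgroup.relIndex_mul_index (kernelSubgroup_le (G := G) p)
  rw [Subgroup.index, Subgroup.index, Subgroup.relIndex, Subgroup.index] at h1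
  rw [← h1]
  congr 1
  let f : gam 2 G →* Multiplicative (commIdeal A) :=
    { toFun := fun n => Multiplicative.ofAdd
        ⟨rho π n - 1, (h.rho_sub_one_mem_commIdeal_iff n).2 n.2⟩
      map_one' := by
        refine congrArg Multiplicative.ofAdd (Subtype.ext ?_)
        simp
      map_mul' := fun m n => by
        refine congrArg Multiplicative.ofAdd (Subtype.ext ?_)
        have := h.isSmall.M_mul_M ((h.rho_sub_one_mem_commIdeal_iff m).2 m.2)
          ((h.rho_sub_one_mem_commIdeal_iff n).2 n.2)
        change rho π (m * n) - 1 = (rho π m - 1) + (rho π n - 1)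
        rw [← sub_eq_zero, ← this, map_mul]
        noncomm_ring }
  have hf : Function.Surjective f := by
    intro m
    obtain ⟨n, hn, hnm⟩ := h.exists_rho_eq m.toAdd.2
    refine ⟨⟨n, hn⟩, congrArg Multiplicative.ofAdd (Subtype.ext ?_)⟩
    change rho π n - 1 = _
    rw [hnm, add_sub_cancel_left]
    rfl
  have hker : f.ker = (kernelSubgroup p G).subgroupOf (gam 2 G) := by
    ext n
    rw [MonoidHom.mem_ker, Subgroup.mem_subgroupOf, ← h.rho_eq_one_iff]
    constructor
    · intro hn
      have := congrArg Subtype.val (Multiplicative.ofAdd.injective hn)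
      exact sub_eq_zero.1 this
    · intro hn
      refine congrArg Multiplicative.ofAdd (Subtype.ext ?_)
      exact sub_eq_zero.2 hn
  rw [← hker]
  exact Nat.card_congr (QuotientGroup.quotientKerEquivOfSurjective f hf).toEquiv

end IsModel

end Model

end BaginskiInvariant

/-! ### Group generators versus spanning sets of D modulo D² -/

namespace BaginskiInvariant

open MonoidAlgebra
open scoped commutatorElement

/-- `X` and `Y` span the ideal `D` additively modulo `D²`. -/
structure Spans {A : Type*} [Ring A] (D : Ideal A) (X Y : A) : Prop where
  left_mem : X ∈ D
  right_mem : Y ∈ D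
  exists_sub_mem : ∀ x ∈ D, ∃ i j : ℤ, x - (i • X + j • Y) ∈ D * D

theorem Spans.congr {A : Type*} [Ring A] {D : Ideal A} {X Y X' Y' : A} (hle : D * D ≤ D)
    (h : Spans D X Y) (hX : X - X' ∈ D * D) (hY : Y - Y' ∈ D * D) : Spans D X' Y' := by
  refine ⟨?_, ?_, fun x hx => ?_⟩
  · have := D.sub_mem h.left_mem (hle hX)
    rwa [sub_sub_cancel] at this
  · have := D.sub_mem h.right_mem (hle hY)
    rwa [sub_sub_cancel] at this
  · obtain ⟨i, j, hij⟩ := h.exists_sub_mem x hx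
    refine ⟨i, j, ?_⟩
    have e : x - (i • X' + j • Y') = x - (i • X + j • Y) + (i • (X - X') + j • (Y - Y')) := by
      rw [smul_sub, smul_sub]
      abel
    rw [e]
    exact Ideal.add_mem _ hij (Ideal.add_mem _ (zsmul_mem hX i) (zsmul_mem hY j))

/-- A family of vectors in a plane has two members spanning all of them. -/
theorem exists_pair_span {F W ι : Type*} [Field F] [AddCommGroup W] [Module F W] (t : ι → W)
    {x y : W} (ht : ∀ i, t i ∈ Submodule.span F {x, y}) (o : ι) :
    ∃ c d : ι, ∀ i, t i ∈ Submodule.span F {t c, t d} := by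
  classical
  obtain ⟨b, hbt, hspan, hli⟩ := exists_linearIndependent F (Set.range t)
  have hsub : Set.range ((↑) : b → W) ≤ (Submodule.span F {x, y} : Submodule F W) := by
    rintro _ ⟨v, rfl⟩
    obtain ⟨i, hi⟩ := hbt v.2
    rw [← hi]
    exact ht i
  have hfin : Finite b := hli.finite_of_le_span_finite _ _ hsub
  let : Fintype b := Fintype.ofFinite b
  have hcard := linearIndependent_le_span_aux' _ hli _ hsub
  have hcard2 : Fintype.card ({x, y} : Set W) ≤ 2 := by
    rw [← Set.toFinset_card]
    simp only [Set.toFinset_insert, Set.toFinset_singleton]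
    exact Finset.card_le_two
  have hb2 : b.toFinset.card ≤ 2 := by
    rw [Set.toFinset_card]
    exact hcard.trans hcard2
  -- A basis chosen among the vectors has at most two members; the index `o` only fills unused
  -- slots.
  obtain ⟨c, d, hcd⟩ : ∃ c d : ι, b ⊆ {t c, t d} := by
    have h3 : b.toFinset.card = 0 ∨ b.toFinset.card = 1 ∨ b.toFinset.card = 2 := by omega
    rcases h3 with h3 | h3 | h3
    · rw [Finset.card_eq_zero, Set.toFinset_eq_empty] at h3
      exact ⟨o, o, by simp [h3]⟩
    · obtain ⟨v, hv⟩ := Finset.card_eq_one.1 h3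
      have hv' : b = {v} := by rw [← Set.coe_toFinset b, hv, Finset.coe_singleton]
      obtain ⟨c, hc⟩ := hbt (show v ∈ b by rw [hv']; rfl)
      refine ⟨c, o, ?_⟩
      rw [hv', ← hc]
      simp
    · obtain ⟨v, v', -, hv⟩ := Finset.card_eq_two.1 h3
      have hv' : b = {v, v'} := by rw [← Set.coe_toFinset b, hv, Finset.coe_pair]
      obtain ⟨c, hc⟩ := hbt (show v ∈ b by rw [hv']; simp)
      obtain ⟨d, hd⟩ := hbt (show v' ∈ b by rw [hv']; simp)
      exact ⟨c, d, by rw [hv', ← hc, ← hd]⟩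
  refine ⟨c, d, fun i => ?_⟩
  have hi : t i ∈ Submodule.span F (Set.range t) := Submodule.subset_span ⟨i, rfl⟩
  rw [← hspan] at hi
  exact Submodule.span_mono hcd hi

section PGroup

variable {p : ℕ} [Fact p.Prime] {G : Type*} [Group G] [Finite G]

/-- A maximal subgroup of a finite `p`-group is normal, with commutative quotient of
exponent `p`. -/
theorem quotient_coatom (hG : IsPGroup p G) {N : Subgroup G} (hN : IsCoatom N) :
    ∃ _ : N.Normal, (∀ x y : G ⧸ N, x * y = y * x) ∧ ∀ x : G ⧸ N, x ^ p = 1 := by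
  have hnil : Group.IsNilpotent G := hG.isNilpotent
  have hNn : N.Normal :=
    Subgroup.NormalizerCondition.normal_of_coatom N Group.normalizerCondition_of_isNilpotent hN
  refine ⟨hNn, ?_⟩
  have hQ : IsPGroup p (G ⧸ N) := hG.to_quotient N
  have hnilQ : Group.IsNilpotent (G ⧸ N) := hQ.isNilpotent
  have hnt : Nontrivial (G ⧸ N) := QuotientGroup.nontrivial_iff.2 hN.1
  have hs : IsSimpleGroup (G ⧸ N) := by
    refine ⟨fun H _ => ?_⟩
    have hle : N ≤ H.comap (QuotientGroup.mk' N) := by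
      intro n hn
      rw [Subgroup.mem_comap, QuotientGroup.mk'_apply, (QuotientGroup.eq_one_iff n).2 hn]
      exact H.one_mem
    rcases hle.lt_or_eq with hlt | heq
    · right
      have := hN.2 _ hlt
      rw [eq_top_iff]
      intro x _
      obtain ⟨g, rfl⟩ := QuotientGroup.mk_surjective x
      have hg : g ∈ H.comap (QuotientGroup.mk' N) := this ▸ Subgroup.mem_top g
      exact hg
    · left
      rw [eq_bot_iff]
      intro x hx
      obtain ⟨g, rfl⟩ := QuotientGroup.mk_surjective x
      have hg : g ∈ H.comap (QuotientGroup.mk' N) := hx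
      rw [← heq] at hg
      exact (QuotientGroup.eq_one_iff g).2 hg
  have hcomm : ∀ x y : G ⧸ N, x * y = y * x :=
    IsSimpleGroup.comm_iff_isSolvable.mpr inferInstance
  refine ⟨hcomm, fun x => ?_⟩
  have hpr : (Nat.card (G ⧸ N)).Prime := by
    let : CommGroup (G ⧸ N) := { QuotientGroup.Quotient.group N with mul_comm := hcomm }
    exact CommGroup.is_simple_iff_prime_card.1 hs
  obtain ⟨k, hk⟩ := IsPGroup.iff_card.1 hQ
  have hpk : Nat.card (G ⧸ N) = p := by
    have h1 : k ≠ 0 := by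
      rintro rfl
      rw [hk, pow_zero] at hpr
      exact Nat.not_prime_one hpr
    have h2 : p ∣ Nat.card (G ⧸ N) := hk ▸ dvd_pow_self p h1
    exact ((Nat.prime_dvd_prime_iff_eq (Fact.out : p.Prime) hpr).1 h2).symm
  rw [← hpk]
  exact pow_card_eq_one'

end PGroup

namespace IsModel

variable {p : ℕ} [Fact p.Prime] {G : Type*} [Group G] {A : Type*} [Ring A]
  {ε : A →+* ZMod p} {π : MonoidAlgebra (ZMod p) G →+* A}

/-- An additive character of the group gives a derivation at the augmentation, which kills the
square of the augmentation ideal. -/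
theorem eq_zero_of_sum_mem_sq (h : IsModel ε π) {W : Type*} [AddCommGroup W] [Module (ZMod p) W]
    (f : G → W) (hf : ∀ g k, f (g * k) = f g + f k) {a b g : G} {i j : ℤ}
    (hz : rho π g - 1 - (i • (rho π a - 1) + j • (rho π b - 1)) ∈ RingHom.ker ε * RingHom.ker ε) :
    f g = i • f a + j • f b := by
  let l : MonoidAlgebra (ZMod p) G →+ W :=
    { toFun := fun x => Finsupp.linearCombination (ZMod p) f x.coeff
      map_zero' := by simp
      map_add' := fun x y => by simp }
  have hlof : ∀ g, l (of (ZMod p) G g) = f g := by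
    intro g
    change Finsupp.linearCombination (ZMod p) f (of (ZMod p) G g).coeff = f g
    simp [of_apply]
  have hf1 : f 1 = 0 := by simpa using hf 1 1
  have hl1 : l 1 = 0 := by rw [← map_one (of (ZMod p) G), hlof, hf1]
  -- The linear extension of an additive character is a derivation at the augmentation, so it kills
  -- D².
  have hder : ∀ x y, l (x * y) = BaginskiInvariant.aug p G x • l y +
      BaginskiInvariant.aug p G y • l x := by
    intro x y
    refine algebra_induction x (fun g => ?_) (by simp) (fun x x' hx hx' => ?_)
    · refine algebra_induction y (fun k => ?_) (by simp) (fun y y' hy hy' => ?_)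
      · rw [← map_mul, hlof, hlof, hlof, hf, aug_of, aug_of, one_smul, one_smul, add_comm]
      · rw [mul_add, map_add, hy, hy', map_add, map_add, smul_add, add_smul]
        abel
    · rw [add_mul, map_add, hx, hx', map_add, map_add, smul_add, add_smul]
      abel
  have hsq : ∀ x ∈ RingHom.ker (BaginskiInvariant.aug p G) *
      RingHom.ker (BaginskiInvariant.aug p G), l x = 0 := by
    intro x hx
    refine IsSmall.sq_induction hx (fun x hx y hy => ?_) (fun x y hx hy => ?_)
    · rw [hder, RingHom.mem_ker.1 hx, RingHom.mem_ker.1 hy, zero_smul, zero_smul, add_zero]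
    · rw [map_add, hx, hy, add_zero]
  have hlift : ∀ z ∈ RingHom.ker ε * RingHom.ker ε,
      ∃ r ∈ RingHom.ker (BaginskiInvariant.aug p G) * RingHom.ker (BaginskiInvariant.aug p G),
        π r = z := by
    intro z hz
    refine IsSmall.sq_induction hz (fun x hx y hy => ?_) ?_
    · obtain ⟨x, rfl⟩ := h.surj x
      obtain ⟨y, rfl⟩ := h.surj y
      rw [RingHom.mem_ker, h.aug] at hx hy
      exact ⟨x * y, Ideal.mul_mem_mul hx hy, map_mul π x y⟩
    · rintro _ _ ⟨r, hr, rfl⟩ ⟨s, hs, rfl⟩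
      exact ⟨r + s, Ideal.add_mem _ hr hs, map_add π r s⟩
  obtain ⟨r, hr, hrz⟩ := hlift _ hz
  let o := of (ZMod p) G
  have h1 : o g - 1 - (i • (o a - 1) + j • (o b - 1)) - r ∈
      smallIdeal (BaginskiInvariant.aug p G) := by
    rw [← h.ker, map_sub, hrz, sub_eq_zero]
    simp only [map_sub, map_add, map_zsmul, map_one, rho_apply, o]
  have h2 := hsq _ (Ideal.add_mem _ (smallIdeal_le_ker_sq _ h1) hr)
  rw [sub_add_cancel, map_sub, map_sub, map_add, map_zsmul, map_zsmul, map_sub, map_sub, hlof,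
    hlof, hlof, hl1, sub_zero, sub_zero, sub_zero, sub_eq_zero] at h2
  exact h2

/-- Burnside's basis argument: if a and b lay in a maximal subgroup N, the character G → G/N would
vanish on both, hence on every g, as it factors through D/D². -/
theorem closure_eq_top [Finite G] (h : IsModel ε π) (hG : IsPGroup p G) {a b : G}
    (hs : Spans (RingHom.ker ε) (rho π a - 1) (rho π b - 1)) :
    Subgroup.closure {a, b} = ⊤ := by
  rcases eq_top_or_exists_le_coatom (Subgroup.closure {a, b}) with htop | ⟨N, hN, hle⟩
  · exact htop
  exfalso
  obtain ⟨hNn, hcomm, hpow⟩ := quotient_coatom hG hN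
  let : CommGroup (G ⧸ N) := { QuotientGroup.Quotient.group N with mul_comm := hcomm }
  let : Module (ZMod p) (Additive (G ⧸ N)) :=
    AddCommGroup.zmodModule (fun x => by
      change Additive.ofMul (x.toMul ^ p) = 0
      exact congrArg Additive.ofMul (hpow x.toMul))
  let f : G → Additive (G ⧸ N) := fun g => Additive.ofMul (g : G ⧸ N)
  have h0 : ∀ g ∈ N, f g = 0 := fun g hg =>
    congrArg Additive.ofMul ((QuotientGroup.eq_one_iff g).2 hg)
  have ha := h0 a (hle (Subgroup.subset_closure (by simp)))
  have hb := h0 b (hle (Subgroup.subset_closure (by simp)))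
  refine hN.1 (eq_top_iff.2 fun g _ => ?_)
  obtain ⟨i, j, hij⟩ := hs.exists_sub_mem _ (h.rho_sub_one_mem g)
  have := h.eq_zero_of_sum_mem_sq f (fun _ _ => rfl) hij
  rw [ha, hb, smul_zero, smul_zero, add_zero] at this
  exact (QuotientGroup.eq_one_iff g).1 (Additive.ofMul.injective this)

theorem spans_of_forall (h : IsModel ε π) {X Y : A} (hX : X ∈ RingHom.ker ε)
    (hY : Y ∈ RingHom.ker ε)
    (hg : ∀ g, ∃ i j : ℤ, rho π g - 1 - (i • X + j • Y) ∈ RingHom.ker ε * RingHom.ker ε) :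
    Spans (RingHom.ker ε) X Y := by
  refine ⟨hX, hY, fun x hx => ?_⟩
  refine AddSubgroup.closure_induction
    (p := fun x _ => ∃ i j : ℤ, x - (i • X + j • Y) ∈ RingHom.ker ε * RingHom.ker ε)
    ?_ ?_ ?_ ?_ (h.ker_le_closure hx)
  · rintro _ ⟨g, rfl⟩
    exact hg g
  · exact ⟨0, 0, by simp⟩
  · rintro x y _ _ ⟨i, j, hij⟩ ⟨i', j', hij'⟩
    refine ⟨i + i', j + j', ?_⟩
    have := Ideal.add_mem _ hij hij'
    have e : x + y - ((i + i') • X + (j + j') • Y) =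
        x - (i • X + j • Y) + (y - (i' • X + j' • Y)) := by
      rw [add_smul, add_smul]; abel
    rwa [e]
  · rintro x _ ⟨i, j, hij⟩
    refine ⟨-i, -j, ?_⟩
    have := Ideal.neg_mem_iff _ |>.2 hij
    have e : -x - (-i • X + -j • Y) = -(x - (i • X + j • Y)) := by
      rw [neg_smul, neg_smul]; abel
    rwa [e]

theorem spans_of_closure (h : IsModel ε π) {a b : G} (hab : Subgroup.closure {a, b} = ⊤) :
    Spans (RingHom.ker ε) (rho π a - 1) (rho π b - 1) := by
  refine h.spans_of_forall (h.rho_sub_one_mem a) (h.rho_sub_one_mem b) fun g => ?_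
  set X := rho π a - 1
  set Y := rho π b - 1
  have hg : g ∈ Subgroup.closure {a, b} := hab ▸ Subgroup.mem_top g
  refine Subgroup.closure_induction
    (p := fun g _ => ∃ i j : ℤ, rho π g - 1 - (i • X + j • Y) ∈ RingHom.ker ε * RingHom.ker ε)
    ?_ ?_ ?_ ?_ hg
  · rintro _ (rfl | rfl)
    · exact ⟨1, 0, by simp [X]⟩
    · exact ⟨0, 1, by simp [Y]⟩
  · exact ⟨0, 0, by simp⟩
  · rintro x y _ _ ⟨i, j, hij⟩ ⟨i', j', hij'⟩
    refine ⟨i + i', j + j', ?_⟩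
    have h1 := Ideal.mul_mem_mul (h.rho_sub_one_mem x) (h.rho_sub_one_mem y)
    have := Ideal.add_mem _ (Ideal.add_mem _ hij hij') h1
    have e : rho π (x * y) - 1 - ((i + i') • X + (j + j') • Y) =
        rho π x - 1 - (i • X + j • Y) + (rho π y - 1 - (i' • X + j' • Y)) +
          (rho π x - 1) * (rho π y - 1) := by
      rw [add_smul, add_smul, map_mul, sub_mul, mul_sub, one_mul, mul_one]; abel
    rwa [e]
  · rintro x _ ⟨i, j, hij⟩
    refine ⟨-i, -j, ?_⟩
    have h1 := Ideal.mul_mem_mul (h.rho_sub_one_mem x⁻¹) (h.rho_sub_one_mem x)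
    have := Ideal.neg_mem_iff _ |>.2 (Ideal.add_mem _ hij h1)
    have e : rho π x⁻¹ - 1 - (-i • X + -j • Y) =
        -(rho π x - 1 - (i • X + j • Y) + (rho π x⁻¹ - 1) * (rho π x - 1)) := by
      rw [neg_smul, neg_smul, sub_mul, mul_sub, one_mul, mul_one, rho_inv_mul]; abel
    rwa [e]

theorem exists_spans_of_quotient (h : IsModel ε π) {X Y : A} (hs : Spans (RingHom.ker ε) X Y)
    {W : Type*} [AddCommGroup W] [Module (ZMod p) W] (mk : A →+ W)
    (hmk : ∀ x, mk x = 0 ↔ x ∈ RingHom.ker ε * RingHom.ker ε) :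
    ∃ c d : G, Spans (RingHom.ker ε) (rho π c - 1) (rho π d - 1) := by
  have hcast : ∀ (n : ZMod p) (x : W), n • x = ((n.val : ℕ) : ℤ) • x := by
    intro n x
    rw [natCast_zsmul, ← Nat.cast_smul_eq_nsmul (ZMod p), ZMod.natCast_zmod_val]
  have ht : ∀ g : G, mk (rho π g - 1) ∈
      (Submodule.span (ZMod p) ({mk X, mk Y} : Set W) : Submodule (ZMod p) W) := by
    intro g
    obtain ⟨i, j, hij⟩ := hs.exists_sub_mem _ (h.rho_sub_one_mem g)
    rw [← hmk, map_sub, sub_eq_zero, map_add, map_zsmul, map_zsmul] at hij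
    rw [hij]
    exact Submodule.add_mem _ (zsmul_mem (Submodule.subset_span (by simp)) i)
      (zsmul_mem (Submodule.subset_span (by simp)) j)
  obtain ⟨c, d, hcd⟩ := exists_pair_span (F := ZMod p) (fun g : G => mk (rho π g - 1)) ht
    1
  refine ⟨c, d, h.spans_of_forall (h.rho_sub_one_mem c) (h.rho_sub_one_mem d) fun g => ?_⟩
  obtain ⟨i, j, hij⟩ := Submodule.mem_span_pair.1 (hcd g)
  refine ⟨(i.val : ℤ), (j.val : ℤ), ?_⟩
  rw [← hmk, map_sub, map_add, map_zsmul, map_zsmul, ← hcast, ← hcast, hij, sub_self]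

/-- If the augmentation ideal is spanned modulo its square by two elements, then it is spanned by
two elements of the form `c - 1`, `d - 1` with `c`, `d` in the group. -/
theorem exists_spans (h : IsModel ε π) {X Y : A} (hs : Spans (RingHom.ker ε) X Y) :
    ∃ c d : G, Spans (RingHom.ker ε) (rho π c - 1) (rho π d - 1) := by
  have hchar := h.charP
  have hp : ∀ x : A ⧸ (RingHom.ker ε * RingHom.ker ε), p • x = 0 := fun x => by
    obtain ⟨x, rfl⟩ := Submodule.mkQ_surjective _ x
    rw [← map_nsmul, nsmul_eq_mul, CharP.cast_eq_zero, zero_mul, map_zero]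
  let := AddCommGroup.zmodModule hp
  exact h.exists_spans_of_quotient hs
    (Submodule.mkQ (RingHom.ker ε * RingHom.ker ε)).toAddMonoidHom
    (fun _ => Submodule.Quotient.mk_eq_zero _)

end IsModel

end BaginskiInvariant

/-! ### Correcting commutators by elements of MD -/

namespace BaginskiInvariant

open MonoidAlgebra
open scoped commutatorElement

section Commutators

variable {A : Type*} [Ring A]

theorem comm_sub_comm_mem {D M : Ideal A} (h : IsSmall D M) {x y x' y' : A}
    (hx : x - x' ∈ D * D) (hy : y - y' ∈ D * D) :
    x * y - y * x - (x' * y' - y' * x') ∈ M * D := by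
  have e : x * y - y * x - (x' * y' - y' * x') =
      (x * (y - y') - (y - y') * x) - (y' * (x - x') - (x - x') * y') := by noncomm_ring
  rw [e]
  exact Ideal.sub_mem _ (h.comm_mem_M_mul_D _ hy) (h.comm_mem_M_mul_D _ hx)

variable {p : ℕ} [Fact p.Prime] {ε : A →+* ZMod p}

theorem exists_intCast_sub_mem (ε : A →+* ZMod p) (a : A) : ∃ c : ℤ, a - c • 1 ∈ RingHom.ker ε := by
  refine ⟨((ε a).val : ℤ), ?_⟩
  rw [RingHom.mem_ker, map_sub, map_zsmul, map_one, natCast_zsmul, nsmul_one,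
    ZMod.natCast_zmod_val, sub_self]

/-- Modulo `M D`, the commutator ideal `M` is generated by the commutator of two elements spanning
`D` modulo `D²`. -/
theorem exists_sub_zsmul_comm_mem (h : IsSmall (RingHom.ker ε) (commIdeal A)) {X Y : A}
    (hs : Spans (RingHom.ker ε) X Y) {m : A} (hm : m ∈ commIdeal A) :
    ∃ r : ℤ, m - r • (X * Y - Y * X) ∈ commIdeal A * RingHom.ker ε := by
  refine Submodule.span_induction
    (p := fun m _ => ∃ r : ℤ, m - r • (X * Y - Y * X) ∈ commIdeal A * RingHom.ker ε)
    ?_ ?_ ?_ ?_ hm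
  · rintro _ ⟨y, z, s, rfl⟩
    obtain ⟨cy, hy⟩ := exists_intCast_sub_mem ε y
    obtain ⟨cz, hz⟩ := exists_intCast_sub_mem ε z
    obtain ⟨cs, hs'⟩ := exists_intCast_sub_mem ε s
    obtain ⟨i, j, hij⟩ := hs.exists_sub_mem _ hy
    obtain ⟨i', j', hij'⟩ := hs.exists_sub_mem _ hz
    have hc := comm_sub_comm_mem h hij hij'
    -- Modulo MD the commutator is an alternating form on D/D², so the coefficient is a determinant;
    -- the right factor s acts through its augmentation.
    have h1 : (y * z - z * y - (i * j' - j * i') • (X * Y - Y * X)) ∈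
        commIdeal A * RingHom.ker ε := by
      convert hc using 1
      simp only [smul_sub, mul_add, add_mul, mul_sub, sub_mul, smul_mul_assoc, mul_smul_comm,
        one_mul, mul_one]
      module
    refine ⟨cs * (i * j' - j * i'), ?_⟩
    have h2 := Ideal.add_mem _ (zsmul_mem h1 cs) (Ideal.mul_mem_mul (comm_mem_commIdeal y z) hs')
    convert h2 using 1
    simp only [smul_sub, mul_sub, sub_mul, mul_smul_comm, mul_one]
    module
  · exact ⟨0, by simp⟩
  · rintro x y _ _ ⟨r, hr⟩ ⟨r', hr'⟩
    refine ⟨r + r', ?_⟩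
    convert Ideal.add_mem _ hr hr' using 1
    module
  · rintro a x hx ⟨r, hr⟩
    obtain ⟨c, hc⟩ := exists_intCast_sub_mem ε a
    have h1 := h.D_mul_M hc hx
    rw [sub_mul, smul_mul_assoc, one_mul, sub_eq_zero] at h1
    refine ⟨c * r, ?_⟩
    rw [smul_eq_mul, h1]
    convert zsmul_mem hr c using 1
    module

theorem exists_eq_of_mem_M_mul_D (h : IsSmall (RingHom.ker ε) (commIdeal A)) {X Y : A}
    (hs : Spans (RingHom.ker ε) X Y) {z : A} (hz : z ∈ commIdeal A * RingHom.ker ε) :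
    ∃ i j : ℤ, z = i • ((X * Y - Y * X) * X) + j • ((X * Y - Y * X) * Y) := by
  refine Submodule.smul_induction_on hz (fun m hm v hv => ?_) ?_
  · obtain ⟨r, hr⟩ := exists_sub_zsmul_comm_mem h hs hm
    obtain ⟨i, j, hij⟩ := hs.exists_sub_mem _ hv
    have h1 := h.M_mul_D_mul hr hv
    have h2 := h.M_mul_sq (comm_mem_commIdeal X Y) hij
    refine ⟨r * i, r * j, ?_⟩
    generalize X * Y - Y * X = w at *
    rw [sub_mul, smul_mul_assoc, sub_eq_zero] at h1
    rw [mul_sub, sub_eq_zero, mul_add, mul_smul_comm, mul_smul_comm] at h2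
    rw [smul_eq_mul, h1, h2]
    module
  · rintro _ _ ⟨i, j, rfl⟩ ⟨i', j', rfl⟩
    exact ⟨i + i', j + j', by module⟩

/-- If `D` is spanned modulo `D²` by a single element then `M D = 0`. -/
theorem M_mul_D_eq_zero_of_mem_sq (h : IsSmall (RingHom.ker ε) (commIdeal A)) {X Y : A}
    (hs : Spans (RingHom.ker ε) X Y) (hY : Y ∈ RingHom.ker ε * RingHom.ker ε) {z : A}
    (hz : z ∈ commIdeal A * RingHom.ker ε) : z = 0 := by
  obtain ⟨i, j, rfl⟩ := exists_eq_of_mem_M_mul_D h hs hz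
  have hw := h.comm_mem_M_mul_D X hY
  rw [h.M_mul_D_mul hw hs.left_mem, h.M_mul_D_mul hw hs.right_mem, smul_zero, smul_zero, add_zero]

/-- If all squares of elements of `D` lie in `M` then `M D = 0`. -/
theorem M_mul_D_eq_zero_of_sq_mem (h : IsSmall (RingHom.ker ε) (commIdeal A)) {X Y : A}
    (hs : Spans (RingHom.ker ε) X Y) (hsq : ∀ x ∈ RingHom.ker ε, x ^ 2 ∈ commIdeal A) {z : A}
    (hz : z ∈ commIdeal A * RingHom.ker ε) : z = 0 := by
  have hX := hsq X hs.left_mem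
  have hY := hsq Y hs.right_mem
  -- With w = [X, Y], X² ≡ rw and Y² ≡ r'w modulo MD: then wX = X²Y = r wY, wY = -Y²X = -r' wX, and
  -- r wX = X³ = 0. Substituting, wX = -r'(r wX) = 0 and so wY = 0.
  obtain ⟨r, hr⟩ := exists_sub_zsmul_comm_mem h hs hX
  obtain ⟨r', hr'⟩ := exists_sub_zsmul_comm_mem h hs hY
  have hwX : (X * Y - Y * X) * X = X ^ 2 * Y := by
    have e : X ^ 2 * Y = X * (X * Y - Y * X) + (X * Y - Y * X) * X + Y * X ^ 2 := by noncomm_ring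
    rw [e, h.D_mul_M hs.left_mem (comm_mem_commIdeal X Y), h.D_mul_M hs.right_mem hX, zero_add,
      add_zero]
  have hwY : (X * Y - Y * X) * Y = -(Y ^ 2 * X) := by
    have e : (X * Y - Y * X) * Y = X * Y ^ 2 - Y ^ 2 * X - Y * (X * Y - Y * X) := by noncomm_ring
    rw [e, h.D_mul_M hs.right_mem (comm_mem_commIdeal X Y), h.D_mul_M hs.left_mem hY, zero_sub,
      sub_zero]
  have h1 := h.M_mul_D_mul hr hs.left_mem
  have h2 := h.M_mul_D_mul hr hs.right_mem
  have h3 := h.M_mul_D_mul hr' hs.left_mem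
  have hX3 : X ^ 2 * X = 0 := by
    rw [← pow_succ, pow_succ', h.D_mul_M hs.left_mem hX]
  obtain ⟨i, j, rfl⟩ := exists_eq_of_mem_M_mul_D h hs hz
  generalize X * Y - Y * X = w at *
  rw [sub_mul, smul_mul_assoc, hX3, zero_sub, neg_eq_zero] at h1
  rw [sub_mul, smul_mul_assoc, ← hwX, sub_eq_zero] at h2
  rw [sub_mul, smul_mul_assoc, sub_eq_zero] at h3
  rw [h3] at hwY
  have hwX0 : w * X = 0 := by
    rw [h2, hwY, smul_neg, smul_comm, h1, smul_zero, neg_zero]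
  simp only [hwY, hwX0, smul_zero, neg_zero, add_zero]

/-- A prescribed element of `M D` can be added to a commutator by changing both entries by elements
of `M`. -/
theorem exists_comm_add_eq (h : IsSmall (RingHom.ker ε) (commIdeal A)) {X Y : A}
    (hs : Spans (RingHom.ker ε) X Y) {z : A} (hz : z ∈ commIdeal A * RingHom.ker ε) :
    ∃ m ∈ commIdeal A, ∃ n ∈ commIdeal A,
      (X + m) * (Y + n) - (Y + n) * (X + m) = X * Y - Y * X + z := by
  obtain ⟨i, j, rfl⟩ := exists_eq_of_mem_M_mul_D h hs hz
  have hw := comm_mem_commIdeal X Y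
  have h1 := h.D_mul_M hs.left_mem hw
  have h2 := h.D_mul_M hs.right_mem hw
  have h3 := h.M_mul_M hw hw
  -- Since Xw = Yw = 0, adding jw to X contributes j wY, and adding -iw to Y contributes i wX.
  refine ⟨j • (X * Y - Y * X), zsmul_mem hw j, -i • (X * Y - Y * X), zsmul_mem hw _, ?_⟩
  have e : ∀ w : A, X * w = 0 → Y * w = 0 → w * w = 0 →
      (X + j • w) * (Y + -i • w) - (Y + -i • w) * (X + j • w) =
        X * Y - Y * X + (i • (w * X) + j • (w * Y)) := by
    intro w h1 h2 h3
    simp only [add_mul, mul_add, smul_mul_assoc, mul_smul_comm, h1, h2, h3, smul_zero]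
    module
  exact e _ h1 h2 h3

/-- In characteristic two, a prescribed element of `M D` can be added to the commutator `[x, y]`,
where `y ≡ Y` modulo `D²`, by replacing the unit `1 + x` by `(1 + x) (1 + X) ^ (2 i) (1 + m)`. -/
theorem exists_comm_add_eq_of_char_two [CharP A 2] (h : IsSmall (RingHom.ker ε) (commIdeal A))
    {X Y x y : A} (hs : Spans (RingHom.ker ε) X Y) (hx : x ∈ RingHom.ker ε)
    (hy : y - Y ∈ RingHom.ker ε * RingHom.ker ε) {z : A}
    (hz : z ∈ commIdeal A * RingHom.ker ε) :
    ∃ i : ℕ, ∃ m ∈ commIdeal A, ∃ x', 1 + x' = (1 + x) * (1 + X) ^ (2 * i) * (1 + m) ∧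
      x - x' ∈ RingHom.ker ε * RingHom.ker ε ∧ x' * y - y * x' = x * y - y * x + z := by
  have h2 : (2 : A) = 0 := by exact_mod_cast CharP.cast_eq_zero A 2
  obtain ⟨i, j, rfl⟩ := exists_eq_of_mem_M_mul_D h hs hz
  -- Only the parity of i matters. The term wX comes from [X², Y], and 1 + X² = (1 + X)² is again a
  -- group element when 1 + X is; y stays unchanged, so its square is preserved.
  obtain ⟨i', hi'⟩ : ∃ i' : ℕ, (i' = 0 ∨ i' = 1) ∧
      i • ((X * Y - Y * X) * X) = i' • ((X * Y - Y * X) * X) := by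
    have h2' : ∀ v : A, (2 : ℤ) • v = 0 := fun v => by
      rw [zsmul_eq_mul]; push_cast; rw [h2, zero_mul]
    rcases Int.even_or_odd' i with ⟨k, rfl | rfl⟩
    · exact ⟨0, Or.inl rfl, by rw [mul_comm, mul_smul, h2', smul_zero, zero_smul]⟩
    · exact ⟨1, Or.inr rfl, by
        rw [add_smul, mul_comm, mul_smul, h2', smul_zero, zero_add, one_smul, one_smul]⟩
  have hX2 : X ^ 2 ∈ RingHom.ker ε * RingHom.ker ε := h.pow_mem_sq hs.left_mem le_rfl
  have hw := comm_mem_commIdeal X Y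
  set w := X * Y - Y * X with hwdef
  have hyD : y ∈ RingHom.ker ε := by
    have := Ideal.add_mem _ (h.sq_le hy) hs.right_mem
    rwa [sub_add_cancel] at this
  have hpow : (1 + X) ^ (2 * i') = 1 + i' • X ^ 2 := by
    rcases hi'.1 with rfl | rfl
    · simp
    · have : (1 + X) ^ 2 = 1 + X ^ 2 + 2 * X := by noncomm_ring
      rw [mul_one, this, h2, zero_mul, add_zero, one_smul]
  have hiX2 : i' • X ^ 2 ∈ RingHom.ker ε * RingHom.ker ε := nsmul_mem hX2 i'
  have hm : j • w ∈ commIdeal A := zsmul_mem hw j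
  refine ⟨i', j • w, hm, x + i' • X ^ 2 + x * (i' • X ^ 2) + j • w, ?_, ?_, ?_⟩
  · have h0 : (x + i' • X ^ 2 + x * (i' • X ^ 2)) * (j • w) = 0 :=
      h.D_mul_M (Ideal.add_mem _ (Ideal.add_mem _ hx (h.sq_le hiX2))
        (Ideal.mul_mem_left _ _ (h.sq_le hiX2))) hm
    have e : (1 + x) * (1 + X) ^ (2 * i') = 1 + (x + i' • X ^ 2 + x * (i' • X ^ 2)) := by
      rw [hpow, mul_add, add_mul, add_mul, mul_one, mul_one, one_mul]
      abel
    rw [e, mul_add, mul_one, add_mul _ _ (j • w), one_mul, h0]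
    abel
  · have e : x - (x + i' • X ^ 2 + x * (i' • X ^ 2) + j • w) =
        -(i' • X ^ 2 + x * (i' • X ^ 2) + j • w) := by abel
    rw [e]
    exact Ideal.neg_mem_iff _ |>.2 (Ideal.add_mem _ (Ideal.add_mem _ hiX2
      (Ideal.mul_mem_left _ _ hiX2)) (h.M_le hm))
  · have c1 : X ^ 2 * y - y * X ^ 2 = w * X := by
      have hc := h.sq_comm hX2 hy
      have e1 : X ^ 2 * Y - Y * X ^ 2 = w * X := by
        have e : X ^ 2 * Y - Y * X ^ 2 = X * w + w * X := by rw [hwdef]; noncomm_ring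
        rw [e, h.D_mul_M hs.left_mem hw, zero_add]
      rw [← e1, ← sub_eq_zero]
      have e2 : X ^ 2 * y - y * X ^ 2 - (X ^ 2 * Y - Y * X ^ 2) =
          X ^ 2 * (y - Y) - (y - Y) * X ^ 2 := by noncomm_ring
      rw [e2, hc.eq, sub_self]
    have c2 : x * (i' • X ^ 2) * y = y * (x * (i' • X ^ 2)) :=
      (h.commute_mul y hx hiX2).eq.symm
    have c3 : w * y = w * Y := by
      rw [← sub_eq_zero, ← mul_sub]
      exact h.M_mul_sq hw hy
    have c4 : y * w = 0 := h.D_mul_M hyD hw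
    rw [hi'.2, ← c1, ← c3]
    simp only [add_mul, mul_add, smul_mul_assoc, mul_smul_comm, c4, smul_zero, smul_sub] at c2 ⊢
    rw [c2]
    abel

end Commutators

end BaginskiInvariant

/-! ### Polynomials in a - 1 and matching of powers -/

namespace BaginskiInvariant

open MonoidAlgebra
open scoped commutatorElement

section Polynomials

variable {p : ℕ} [Fact p.Prime]

theorem expand_prime_pow (n : ℕ) (P : Polynomial (ZMod p)) :
    Polynomial.expand (ZMod p) (p ^ n) P = P ^ p ^ n := by
  induction n with
  | zero => simp
  | succ n ih => rw [pow_succ', ← Polynomial.expand_expand, ih, ZMod.expand_card, ← pow_mul, mul_comm]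

/-- The powers of a group element of order `N` are linearly independent up to exponent `N`. -/
theorem eq_zero_of_aeval_of_eq_zero {Q : Type*} [Group Q] (u : Q) {S : Polynomial (ZMod p)}
    (hS : S.natDegree < orderOf u) (h0 : Polynomial.aeval (of (ZMod p) Q u) S = 0) : S = 0 := by
  ext j
  rw [Polynomial.coeff_zero]
  rcases Nat.lt_or_ge j (orderOf u) with hj | hj
  · rw [Polynomial.aeval_eq_sum_range' hS] at h0
    have h1 := congrArg (fun x => x.coeff (u ^ j)) h0
    simp only [of_apply, MonoidAlgebra.coeff_sum, MonoidAlgebra.coeff_zero,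
      Finsupp.coe_zero, Pi.zero_apply, Finsupp.finsetSum_apply] at h1
    rw [Finset.sum_eq_single j] at h1
    · simpa using h1
    · intro i hi hij
      have hne : u ^ i ≠ u ^ j := fun hu =>
        hij (pow_injOn_Iio_orderOf (Finset.mem_range.1 hi) hj hu)
      simp [hne]
    · intro hj'
      exact absurd (Finset.mem_range.2 hj) hj'
  · exact Polynomial.coeff_eq_zero_of_natDegree_lt (hS.trans_le hj)

/-- The minimal polynomial of u - 1 is X^(p^m): it annihilates by Frobenius, and a remainder of
smaller degree, shifted by X ↦ X - 1, would be a relation among distinct powers of u. -/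
theorem X_pow_dvd_of_aeval_eq_zero {Q : Type*} [Group Q] (u : Q) {m : ℕ} (hu : orderOf u = p ^ m)
    {P : Polynomial (ZMod p)} (h0 : Polynomial.aeval (of (ZMod p) Q u - 1) P = 0) :
    Polynomial.X ^ p ^ m ∣ P := by
  have hmon : (Polynomial.X ^ p ^ m : Polynomial (ZMod p)).Monic := Polynomial.monic_X_pow _
  rw [← Polynomial.modByMonic_eq_zero_iff_dvd hmon]
  set S := P %ₘ Polynomial.X ^ p ^ m with hS
  have hchar := charP_monoidAlgebra (p := p) Q
  have hS0 : Polynomial.aeval (of (ZMod p) Q u - 1) S = 0 := by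
    have h1 := congrArg (Polynomial.aeval (of (ZMod p) Q u - 1))
      (Polynomial.modByMonic_add_div P (Polynomial.X ^ p ^ m))
    rw [map_add, map_mul, map_pow, Polynomial.aeval_X,
      sub_pow_char_pow_of_commute _ _ (Commute.one_right _), one_pow, ← map_pow, ← hu,
      pow_orderOf_eq_one, map_one, sub_self, zero_mul, add_zero, h0] at h1
    rw [hS, ← hu]
    exact h1
  have hdeg : S.natDegree < p ^ m := by
    have := Polynomial.natDegree_modByMonic_lt P hmon (by
      intro h
      have := congrArg Polynomial.natDegree h
      rw [Polynomial.natDegree_X_pow, Polynomial.natDegree_one] at this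
      exact (pow_ne_zero m (Fact.out : p.Prime).ne_zero) this)
    rwa [Polynomial.natDegree_X_pow] at this
  have hcomp : S.comp (Polynomial.X - 1) = 0 := by
    refine eq_zero_of_aeval_of_eq_zero u ?_ ?_
    · rw [hu]
      refine lt_of_le_of_lt Polynomial.natDegree_comp_le ?_
      have : (Polynomial.X - 1 : Polynomial (ZMod p)).natDegree = 1 := by
        simpa using Polynomial.natDegree_X_sub_C (1 : ZMod p)
      rw [this, mul_one]
      exact hdeg
    · rw [Polynomial.aeval_comp, map_sub, Polynomial.aeval_X, map_one]
      exact hS0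
  have := congrArg (fun T => Polynomial.comp T (Polynomial.X + 1)) hcomp
  simpa [Polynomial.comp_assoc] using this

end Polynomials

namespace IsModel

variable {p : ℕ} [Fact p.Prime] {G : Type*} [Group G] {A : Type*} [Ring A]
  {ε : A →+* ZMod p} {π : MonoidAlgebra (ZMod p) G →+* A}

theorem X_pow_dvd_of_aeval_mem [Algebra (ZMod p) A] (h : IsModel ε π) {a : G} {m : ℕ}
    (ha : orderOf (a : G ⧸ gam 2 G) = p ^ m) {P : Polynomial (ZMod p)}
    (hP : Polynomial.aeval (rho π a - 1) P ∈ commIdeal A) : Polynomial.X ^ p ^ m ∣ P := by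
  refine X_pow_dvd_of_aeval_eq_zero (a : G ⧸ gam 2 G) ha ?_
  have h1 : π (Polynomial.aeval (of (ZMod p) G a - 1) P) = Polynomial.aeval (rho π a - 1) P := by
    rw [Polynomial.aeval_def, Polynomial.aeval_def, Polynomial.hom_eval₂, map_sub, map_one,
      ← rho_apply]
    congr 1
    exact Subsingleton.elim _ _
  rw [← h1, h.map_mem_commIdeal_iff] at hP
  rw [← hP, Polynomial.aeval_def, Polynomial.aeval_def, Polynomial.hom_eval₂, map_sub, map_one,
    abMap_of]
  congr 1
  exact Subsingleton.elim _ _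

theorem add_pow_sub_mem (h : IsModel ε π) (x y : A) (k : ℕ) :
    (x + y) ^ p ^ k - (x ^ p ^ k + y ^ p ^ k) ∈ commIdeal A := by
  obtain ⟨r, rfl⟩ := h.surj x
  obtain ⟨s, rfl⟩ := h.surj y
  have hchar := charP_monoidAlgebra (p := p) (G ⧸ gam 2 G)
  rw [← map_add, ← map_pow, ← map_pow, ← map_pow, ← map_add, ← map_sub, h.map_mem_commIdeal_iff,
    map_sub, map_add, map_pow, map_pow, map_pow, map_add,
    add_pow_char_pow_of_commute _ _ (abAlgebra_comm _ _), sub_self]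

/-- Modulo `M`, the ring is generated by `X = a - 1` and `Y = b - 1`; hence every element is the sum
of a polynomial in `X`, a right multiple of `Y` and an element of `M`. -/
theorem exists_eq_aeval_add [Finite G] [Algebra (ZMod p) A] (h : IsModel ε π) {a b : G}
    (hab : Subgroup.closure {a, b} = ⊤) (x : A) :
    ∃ (P : Polynomial (ZMod p)) (f : A), ∃ m ∈ commIdeal A,
      x = Polynomial.aeval (rho π a - 1) P + (rho π b - 1) * f + m := by
  set X := rho π a - 1 with hX
  set Y := rho π b - 1 with hY
  let T : Set A := {x | ∃ (P : Polynomial (ZMod p)) (f : A), ∃ m ∈ commIdeal A,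
      x = Polynomial.aeval X P + Y * f + m}
  have hadd : ∀ x ∈ T, ∀ y ∈ T, x + y ∈ T := by
    rintro _ ⟨P, f, m, hm, rfl⟩ _ ⟨P', f', m', hm', rfl⟩
    refine ⟨P + P', f + f', m + m', Ideal.add_mem _ hm hm', ?_⟩
    rw [map_add, mul_add]
    abel
  have hmul : ∀ x ∈ T, ∀ y ∈ T, x * y ∈ T := by
    rintro _ ⟨P, f, m, hm, rfl⟩ _ ⟨P', f', m', hm', rfl⟩
    refine ⟨P * P', Polynomial.aeval X P * f' + f * (Polynomial.aeval X P' + Y * f' + m'),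
      (Polynomial.aeval X P * Y - Y * Polynomial.aeval X P) * f' +
        (Polynomial.aeval X P * m' + m * (Polynomial.aeval X P' + Y * f' + m')), ?_, ?_⟩
    · exact Ideal.add_mem _ (Ideal.mul_mem_right _ _ (comm_mem_commIdeal _ _))
        (Ideal.add_mem _ (Ideal.mul_mem_left _ _ hm') (Ideal.mul_mem_right _ _ hm))
    · rw [map_mul]
      noncomm_ring
  have hone : (1 : A) ∈ T := ⟨1, 0, 0, Ideal.zero_mem _, by simp⟩
  have hpow : ∀ x ∈ T, ∀ k : ℕ, x ^ k ∈ T := by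
    intro x hx k
    induction k with
    | zero => rw [pow_zero]; exact hone
    | succ k ih => rw [pow_succ]; exact hmul _ ih _ hx
  have hrho : ∀ g, rho π g ∈ T := by
    intro g
    have hg : g ∈ Subgroup.closure {a, b} := hab ▸ Subgroup.mem_top g
    refine Subgroup.closure_induction (p := fun g _ => rho π g ∈ T) ?_ ?_ ?_ ?_ hg
    · rintro _ (rfl | rfl)
      · exact ⟨1 + Polynomial.X, 0, 0, Ideal.zero_mem _, by simp [hX]⟩
      · exact ⟨1, 1, 0, Ideal.zero_mem _, by simp [hY]⟩
    · rw [map_one]; exact hone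
    · intro x y _ _ hx hy
      rw [map_mul]; exact hmul _ hx _ hy
    · intro x _ hx
      have : x⁻¹ = x ^ (Nat.card G - 1) := by
        rw [inv_eq_iff_mul_eq_one, ← pow_succ', Nat.sub_add_cancel Nat.card_pos, pow_card_eq_one']
      rw [this, map_pow]
      exact hpow _ hx _
  obtain ⟨r, rfl⟩ := h.surj x
  refine algebra_induction r hrho ?_ (fun x y hx hy => ?_)
  · exact ⟨0, 0, 0, Ideal.zero_mem _, by simp⟩
  · rw [map_add]
    exact hadd _ hx _ hy

/-- Modulo D² the map g ↦ g - 1 is a homomorphism, so its image is a subgroup of D/D²; it generates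
D/D² and hence is everything. -/
theorem exists_lift (h : IsModel ε π) {x : A} (hx : x ∈ RingHom.ker ε) :
    ∃ g : G, x - (rho π g - 1) ∈ RingHom.ker ε * RingHom.ker ε := by
  refine AddSubgroup.closure_induction
    (p := fun x _ => ∃ g : G, x - (rho π g - 1) ∈ RingHom.ker ε * RingHom.ker ε)
    ?_ ?_ ?_ ?_ (h.ker_le_closure hx)
  · rintro _ ⟨g, rfl⟩
    exact ⟨g, by simp⟩
  · exact ⟨1, by simp⟩
  · rintro x y _ _ ⟨g, hg⟩ ⟨k, hk⟩
    refine ⟨g * k, ?_⟩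
    have e : x + y - (rho π (g * k) - 1) = x - (rho π g - 1) + (y - (rho π k - 1)) -
        (rho π g - 1) * (rho π k - 1) := by
      rw [map_mul]; noncomm_ring
    rw [e]
    exact Ideal.sub_mem _ (Ideal.add_mem _ hg hk)
      (Ideal.mul_mem_mul (h.rho_sub_one_mem g) (h.rho_sub_one_mem k))
  · rintro x _ ⟨g, hg⟩
    refine ⟨g⁻¹, ?_⟩
    have e : -x - (rho π g⁻¹ - 1) = -(x - (rho π g - 1)) +
        (rho π g⁻¹ - 1) * (rho π g - 1) := by
      rw [sub_mul, mul_sub, rho_inv_mul]; noncomm_ring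
    rw [e]
    exact Ideal.add_mem _ (Ideal.neg_mem_iff _ |>.2 hg)
      (Ideal.mul_mem_mul (h.rho_sub_one_mem _) (h.rho_sub_one_mem g))

/-- Let `a`, `b` generate the group, with `a` of order `p ^ m` and `b` of order dividing `p ^ n`
modulo `γ₂`, where `0 < n < m`. An element `y` with `y ^ (p ^ n) ∈ M` agrees
modulo `D²` with some `b' - 1` having the same `p ^ n`-th power. -/
theorem exists_pow_eq [Finite G] (h : IsModel ε π) {a b : G} (hab : Subgroup.closure {a, b} = ⊤)
    {m n : ℕ} (hn : n ≠ 0) (hnm : n < m) (ha : orderOf (a : G ⧸ gam 2 G) = p ^ m)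
    (hb : b ^ p ^ n ∈ gam 2 G) {y : A}
    (hyM : y ^ p ^ n ∈ commIdeal A) :
    ∃ (b' : G) (s : ℤ), y - (rho π b' - 1) ∈ RingHom.ker ε * RingHom.ker ε ∧
      y ^ p ^ n = (rho π b' - 1) ^ p ^ n ∧
      rho π b' - 1 - s • (rho π b - 1) ∈ RingHom.ker ε * RingHom.ker ε := by
  have hchar := h.charP
  let : Algebra (ZMod p) A := ZMod.algebra A p
  have hS := h.isSmall
  have hp := (Fact.out : p.Prime)
  have hq2 : 2 ≤ p ^ n := IsSmall.two_le_prime_pow hn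
  obtain ⟨P, f, μ, hμ, hyP⟩ := h.exists_eq_aeval_add hab y
  have hXD := h.rho_sub_one_mem a
  have hYD := h.rho_sub_one_mem b
  have hrhob : rho π b = 1 + (rho π b - 1) := by abel
  have hrhoa : rho π a = 1 + (rho π a - 1) := by abel
  have hXM : (rho π a - 1) ^ p ^ m ∈ commIdeal A := by
    rw [sub_pow_char_pow_of_commute _ _ (Commute.one_right _), one_pow, ← map_pow,
      h.rho_sub_one_mem_commIdeal_iff, ← QuotientGroup.eq_one_iff, QuotientGroup.mk_pow, ← ha,
      pow_orderOf_eq_one]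
  have hYM : (rho π b - 1) ^ p ^ n ∈ commIdeal A := by
    rw [sub_pow_char_pow_of_commute _ _ (Commute.one_right _), one_pow, ← map_pow,
      h.rho_sub_one_mem_commIdeal_iff]
    exact hb
  have hdvd : ∀ {Q : Polynomial (ZMod p)}, Polynomial.aeval (rho π a - 1) Q ∈ commIdeal A →
      Polynomial.X ^ p ^ m ∣ Q := fun hQ => h.X_pow_dvd_of_aeval_mem ha hQ
  generalize hX : rho π a - 1 = X at *
  generalize hY : rho π b - 1 = Y at *
  set e := p ^ (m - n) with he
  have heq : e * p ^ n = p ^ m := by rw [he, ← pow_add, Nat.sub_add_cancel hnm.le]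
  have he2 : 2 ≤ e := IsSmall.two_le_prime_pow (by omega)
  -- the polynomial part is divisible by `X ^ e`
  have hPM : Polynomial.aeval X P ^ p ^ n ∈ commIdeal A := by
    have h1 := h.add_pow_sub_mem (Polynomial.aeval X P + Y * f) μ n
    have h2 := h.add_pow_sub_mem (Polynomial.aeval X P) (Y * f) n
    rw [← hyP] at h1
    have h3 : (Y * f) ^ p ^ n ∈ commIdeal A := by
      rw [hS.mul_pow hYD]
      exact Ideal.mul_mem_right _ _ hYM
    rw [hS.M_pow hμ hq2, add_zero] at h1
    have h4 := Ideal.sub_mem _ hyM h1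
    rw [sub_sub_cancel] at h4
    have h5 := Ideal.sub_mem _ (Ideal.sub_mem _ h4 h2) h3
    have e : ∀ u v w : A, u - (u - (v + w)) - w = v := fun u v w => by abel
    rwa [e] at h5
  -- P(X)^(p^n) is P evaluated at X^(p^n), as Frobenius fixes the coefficients; divisibility by
  -- X^(p^m) therefore forces X^e to divide P.
  obtain ⟨P₁, rfl⟩ : Polynomial.X ^ e ∣ P := by
    have h1 : Polynomial.X ^ p ^ m ∣ Polynomial.expand (ZMod p) (p ^ n) P := by
      rw [expand_prime_pow]
      refine hdvd ?_
      rw [map_pow]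
      exact hPM
    rw [Polynomial.X_pow_dvd_iff] at h1 ⊢
    intro d hd
    have h2 := h1 (d * p ^ n) (by
      rw [← heq]
      exact Nat.mul_lt_mul_of_pos_right hd (by omega))
    rwa [Polynomial.coeff_expand_mul (by omega)] at h2
  obtain ⟨k, hk, hkμ⟩ := h.exists_rho_eq hμ
  -- The exponents of the group element b^s a^(ej) k copy the leading terms of y: s is the
  -- augmentation of f, j the constant term of P₁, and k realizes μ exactly.
  let j := (P₁.coeff 0).val
  let s := (ε f).val
  let S : Polynomial (ZMod p) := ∑ i ∈ Finset.range j, (1 + Polynomial.X ^ e) ^ i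
  let S' : A := ∑ i ∈ Finset.range s, (1 + Y) ^ i
  have hV : (1 + Y) ^ s = 1 + Y * S' := by
    have h1 := (Commute.one_right (1 + Y)).mul_geom_sum₂ s
    simp only [one_pow, mul_one, add_sub_cancel_left] at h1
    rw [h1]
    abel
  have hU : (1 + X) ^ (e * j) = 1 + Polynomial.aeval X (Polynomial.X ^ e * S) := by
    have h1 := (Commute.one_right (1 + Polynomial.X ^ e : Polynomial (ZMod p))).mul_geom_sum₂ j
    simp only [one_pow, mul_one, add_sub_cancel_left] at h1
    rw [h1, pow_mul, he, add_pow_char_pow_of_commute _ _ (Commute.one_left X), one_pow]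
    simp
  obtain ⟨R, hR⟩ : Polynomial.X ∣ P₁ - S := by
    rw [Polynomial.X_dvd_iff, Polynomial.coeff_sub, sub_eq_zero,
      Polynomial.coeff_zero_eq_eval_zero S]
    simp only [S, Polynomial.eval_finsetSum, Polynomial.eval_pow, Polynomial.eval_add,
      Polynomial.eval_one, Polynomial.eval_X]
    rw [zero_pow (by omega), add_zero]
    simp only [one_pow, Finset.sum_const, Finset.card_range, nsmul_one]
    rw [ZMod.natCast_zmod_val]
  set U := Polynomial.aeval X (Polynomial.X ^ e * S) with hUdef
  have hUD : U ∈ RingHom.ker ε * RingHom.ker ε := by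
    rw [hUdef, map_mul, map_pow, Polynomial.aeval_X]
    exact hS.right_sq _ (hS.pow_mem_sq hXD he2)
  have hεS' : ε S' = s := by
    have hεY : ε Y = 0 := hYD
    simp only [S', map_sum, map_pow, map_add, map_one, hεY, add_zero, one_pow, Finset.sum_const,
      Finset.card_range, nsmul_one]
  set g := f - S' - S' * U with hg
  have hgD : g ∈ RingHom.ker ε := by
    have hεU : ε U = 0 := hS.sq_le hUD
    rw [RingHom.mem_ker, hg, map_sub, map_sub, map_mul, hεU, mul_zero, sub_zero, hεS',
      ZMod.natCast_zmod_val, sub_self]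
  have hb' : rho π (b ^ s * a ^ (e * j) * k) - 1 = Y * S' + U + Y * S' * U + μ := by
    have h0 : (Y * S' + U + Y * S' * U) * μ = 0 :=
      hS.D_mul_M (Ideal.add_mem _ (Ideal.add_mem _ (Ideal.mul_mem_right _ _ hYD) (hS.sq_le hUD))
        (Ideal.mul_mem_left _ _ (hS.sq_le hUD))) hμ
    have e1 : (1 + Y * S') * (1 + U) = 1 + (Y * S' + U + Y * S' * U) := by noncomm_ring
    rw [map_mul, map_mul, map_pow, map_pow, hrhob, hrhoa, hkμ, hU, hV, e1, mul_add, mul_one,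
      add_mul _ _ μ, h0, one_mul]
    abel
  set ζ₁ := X ^ (e + 1) * Polynomial.aeval X R with hζ₁
  have hdiff : y - (rho π (b ^ s * a ^ (e * j) * k) - 1) = ζ₁ + Y * g := by
    have e1 : Polynomial.aeval X (Polynomial.X ^ e * P₁) = U + ζ₁ := by
      have : Polynomial.X ^ e * P₁ =
          Polynomial.X ^ e * S + Polynomial.X ^ (e + 1) * R := by
        rw [pow_succ, mul_assoc, ← hR]
        ring
      rw [this, map_add, hUdef, hζ₁]
      congr 1
      rw [map_mul, map_pow, Polynomial.aeval_X]
    rw [hb', hyP, e1, hg]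
    noncomm_ring
  have hζ₁D : ζ₁ ∈ RingHom.ker ε * RingHom.ker ε :=
    hS.right_sq _ (hS.pow_mem_sq hXD (by omega))
  have hζ₂D : Y * g ∈ RingHom.ker ε * RingHom.ker ε := Ideal.mul_mem_mul hYD hgD
  have hs : rho π (b ^ s * a ^ (e * j) * k) - 1 - (s : ℤ) • Y ∈
      RingHom.ker ε * RingHom.ker ε := by
    have e1 : Y * S' + U + Y * S' * U + μ - (s : ℤ) • Y =
        Y * (S' - s) + U + Y * S' * U + μ := by
      rw [natCast_zsmul, nsmul_eq_mul, (Nat.cast_commute s Y).eq]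
      noncomm_ring
    rw [hb', e1]
    refine Ideal.add_mem _ (Ideal.add_mem _ (Ideal.add_mem _ (Ideal.mul_mem_mul hYD ?_) hUD)
      (Ideal.mul_mem_left _ _ hUD)) (hS.M_le hμ)
    rw [RingHom.mem_ker, map_sub, hεS', map_natCast, sub_self]
  refine ⟨b ^ s * a ^ (e * j) * k, s, ?_, ?_, hs⟩
  · rw [hdiff]
    exact Ideal.add_mem _ hζ₁D hζ₂D
  set y' := rho π (b ^ s * a ^ (e * j) * k) - 1 with hy'
  -- The error is ζ₁, central as an element of D · D², plus Yg, which commutes with D² and with Y;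
  -- and y' is a multiple of Y modulo D².
  have hc : Commute y' (ζ₁ + Y * g) := by
    refine Commute.add_right ?_ ?_
    · rw [hζ₁, pow_succ', mul_assoc]
      exact hS.commute_mul _ hXD (hS.right_sq _ (hS.pow_mem_sq hXD he2))
    · have e1 : y' = (y' - (s : ℤ) • Y) + (s : ℤ) • Y := by abel
      rw [e1]
      refine Commute.add_left (hS.sq_comm hs hζ₂D) (Commute.smul_left ?_ _)
      rw [commute_iff_eq, mul_assoc, hS.mul_right_comm' hYD g Y]
  have hyy : y = y' + (ζ₁ + Y * g) := by rw [← hdiff]; abel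
  -- The power of Yg lies in M D², and that of ζ₁ contains X^(p^n) X^(p^m), which lies in DM.
  have hζ : (ζ₁ + Y * g) ^ p ^ n = 0 := by
    rw [hS.add_pow_of_sq hζ₁D hζ₂D, hS.mul_pow hYD,
      hS.M_mul_sq hYM (hS.pow_mem_sq hgD hq2), hζ₁, hS.mul_pow (hS.pow_mem hXD (by omega)),
      ← pow_mul, add_mul, one_mul, heq, add_comm (p ^ m), pow_add,
      hS.D_mul_M (hS.pow_mem hXD (by omega)) hXM, zero_mul, add_zero]
  conv_lhs => rw [hyy, add_pow_char_pow_of_commute _ _ hc, hζ, add_zero]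

end IsModel

end BaginskiInvariant

/-! ### Isomorphism by counting, and adapted generators -/

namespace BaginskiInvariant

open MonoidAlgebra
open scoped commutatorElement

section Groups

/-- Two finite groups are isomorphic if pairs of generators `g₁`, `g₂` generate, modulo a subgroup
`T` of the product which they normalize, an abelian group so small that the subgroup they generate
cannot be larger than either group. -/
theorem nonempty_mulEquiv_of_pairs {Γ₁ Γ₂ : Type*} [Group Γ₁] [Group Γ₂] [Finite Γ₁] [Finite Γ₂]
    (T : Subgroup (Γ₁ × Γ₂)) (g₁ g₂ : Γ₁ × Γ₂) {P Q : ℕ} (hP : P ≠ 0) (hQ : Q ≠ 0)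
    (hn₁ : ∀ t ∈ T, g₁ * t * g₁⁻¹ ∈ T) (hn₂ : ∀ t ∈ T, g₂ * t * g₂⁻¹ ∈ T)
    (hc : ⁅g₁, g₂⁆ ∈ T) (h₁ : g₁ ^ P ∈ T) (h₂ : g₂ ^ Q ∈ T)
    (hcard₁ : Nat.card T * (P * Q) ≤ Nat.card Γ₁) (hcard₂ : Nat.card T * (P * Q) ≤ Nat.card Γ₂)
    (hs₁ : Subgroup.closure {g₁.1, g₂.1} = ⊤) (hs₂ : Subgroup.closure {g₁.2, g₂.2} = ⊤) :
    Nonempty (Γ₁ ≃* Γ₂) := by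
  let N := Subgroup.normalizer (T : Set (Γ₁ × Γ₂))
  have hN₁ : g₁ ∈ N := Subgroup.mem_normalizer_fintype hn₁
  have hN₂ : g₂ ∈ N := Subgroup.mem_normalizer_fintype hn₂
  let T' := T.subgroupOf N
  have hT' : T'.Normal := Subgroup.normal_in_normalizer
  let L := Subgroup.closure {g₁, g₂}
  let u : N ⧸ T' := QuotientGroup.mk ⟨g₁, hN₁⟩
  let v : N ⧸ T' := QuotientGroup.mk ⟨g₂, hN₂⟩
  have huv : Commute u v := by
    rw [← commutatorElement_eq_one_iff_commute]
    exact (QuotientGroup.eq_one_iff ⁅(⟨g₁, hN₁⟩ : N), (⟨g₂, hN₂⟩ : N)⁆).2 hc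
  have huP : u ^ P = 1 := (QuotientGroup.eq_one_iff ((⟨g₁, hN₁⟩ : N) ^ P)).2 h₁
  have hvQ : v ^ Q = 1 := (QuotientGroup.eq_one_iff ((⟨g₂, hN₂⟩ : N) ^ Q)).2 h₂
  have hL : ∀ x ∈ L, ∃ hx : x ∈ N, ∃ i j : ℤ, (QuotientGroup.mk ⟨x, hx⟩ : N ⧸ T') =
      u ^ i * v ^ j := by
    intro x hx
    refine Subgroup.closure_induction (p := fun x _ => ∃ hx : x ∈ N, ∃ i j : ℤ,
      (QuotientGroup.mk ⟨x, hx⟩ : N ⧸ T') = u ^ i * v ^ j) ?_ ?_ ?_ ?_ hx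
    · rintro _ (rfl | rfl)
      · exact ⟨hN₁, 1, 0, by simp [u]⟩
      · exact ⟨hN₂, 0, 1, by simp [v]⟩
    · exact ⟨N.one_mem, 0, 0, by
        rw [zpow_zero, zpow_zero, mul_one]; exact (QuotientGroup.eq_one_iff (1 : N)).2 T'.one_mem⟩
    · rintro x y _ _ ⟨hx, i, j, hij⟩ ⟨hy, i', j', hij'⟩
      refine ⟨N.mul_mem hx hy, i + i', j + j', ?_⟩
      change (QuotientGroup.mk ⟨x, hx⟩ : N ⧸ T') * QuotientGroup.mk ⟨y, hy⟩ = _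
      rw [hij, hij', zpow_add, zpow_add, mul_assoc, ← mul_assoc (v ^ j),
        (huv.zpow_zpow i' j).eq.symm]
      simp only [mul_assoc]
    · rintro x _ ⟨hx, i, j, hij⟩
      refine ⟨N.inv_mem hx, -i, -j, ?_⟩
      change (QuotientGroup.mk ⟨x, hx⟩ : N ⧸ T')⁻¹ = _
      rw [hij, mul_inv_rev, ← zpow_neg, ← zpow_neg, (huv.zpow_zpow (-i) (-j)).eq]
  have hred : ∀ {w : N ⧸ T'} {R : ℕ}, R ≠ 0 → w ^ R = 1 → ∀ i : ℤ, ∃ k : Fin R,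
      w ^ i = w ^ (k : ℕ) := by
    intro w R hR hw i
    have hR' : (0 : ℤ) < R := by exact_mod_cast Nat.pos_of_ne_zero hR
    have h0 := Int.emod_nonneg i hR'.ne'
    have h1 := Int.emod_lt_of_pos i hR'
    refine ⟨⟨(i % R).toNat, by omega⟩, ?_⟩
    rw [← zpow_natCast, Int.toNat_of_nonneg h0]
    conv_lhs => rw [← Int.emod_add_mul_ediv i R, zpow_add, zpow_mul, zpow_natCast, hw, one_zpow,
      mul_one]
  -- Modulo T the generated subgroup consists of products u^i v^j with i < P and j < Q, which bounds
  -- its order; a surjection onto a factor at least as large is bijective.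
  let F : Fin P × Fin Q × T → Γ₁ × Γ₂ := fun x => g₁ ^ (x.1 : ℕ) * g₂ ^ (x.2.1 : ℕ) * x.2.2
  have hF : (L : Set (Γ₁ × Γ₂)) ⊆ Set.range F := by
    intro x hx
    obtain ⟨hxN, i, j, hij⟩ := hL x hx
    obtain ⟨i, hi⟩ := hred hP huP i
    obtain ⟨j, hj⟩ := hred hQ hvQ j
    rw [hi, hj] at hij
    have h3 : (⟨g₁, hN₁⟩ ^ (i : ℕ) * ⟨g₂, hN₂⟩ ^ (j : ℕ) : N)⁻¹ * ⟨x, hxN⟩ ∈ T' :=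
      QuotientGroup.eq.1 hij.symm
    refine ⟨(i, j, ⟨(g₁ ^ (i : ℕ) * g₂ ^ (j : ℕ))⁻¹ * x, h3⟩), ?_⟩
    exact mul_inv_cancel_left _ _
  have hcardL : Nat.card L ≤ Nat.card T * (P * Q) := by
    have h1 : Nat.card L ≤ Nat.card (Set.range F) := Nat.card_mono (Set.toFinite _) hF
    have h2 : Nat.card (Set.range F) ≤ Nat.card (Fin P × Fin Q × T) := Finite.card_range_le F
    rw [Nat.card_prod, Nat.card_prod, Nat.card_fin, Nat.card_fin] at h2
    calc Nat.card L ≤ P * (Q * Nat.card T) := h1.trans h2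
      _ = _ := by ring
  have hb₁ : Function.Bijective ((MonoidHom.fst Γ₁ Γ₂).comp L.subtype) := by
    refine Function.Surjective.bijective_of_nat_card_le ?_ (hcardL.trans hcard₁)
    rw [← MonoidHom.range_eq_top, MonoidHom.range_comp, Subgroup.range_subtype,
      MonoidHom.map_closure, Set.image_pair]
    exact hs₁
  have hb₂ : Function.Bijective ((MonoidHom.snd Γ₁ Γ₂).comp L.subtype) := by
    refine Function.Surjective.bijective_of_nat_card_le ?_ (hcardL.trans hcard₂)
    rw [← MonoidHom.range_eq_top, MonoidHom.range_comp, Subgroup.range_subtype,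
      MonoidHom.map_closure, Set.image_pair]
    exact hs₂
  exact ⟨(MulEquiv.ofBijective _ hb₁).symm.trans (MulEquiv.ofBijective _ hb₂)⟩

variable {p : ℕ} [Fact p.Prime]

/-- A finite abelian `p`-group generated by `a` and `b`, where `b` has order at most that of `a`,
is the direct product of the cyclic groups generated by `a` and some `b * a ^ k`. -/
theorem exists_complement {Q : Type*} [CommGroup Q] [Finite Q] {a b : Q}
    (hab : Subgroup.closure {a, b} = ⊤) {m l : ℕ} (ha : orderOf a = p ^ m)
    (hb : orderOf b = p ^ l) (hlm : l ≤ m) :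
    ∃ (k : ℤ) (n : ℕ), n ≤ m ∧ (b * a ^ k) ^ p ^ n = 1 ∧ Nat.card Q = p ^ (m + n) := by
  have hp := (Fact.out : p.Prime)
  let Z := Subgroup.zpowers a
  let β : Q ⧸ Z := QuotientGroup.mk b
  have hβl : orderOf β ∣ p ^ l := hb ▸ orderOf_map_dvd (QuotientGroup.mk' Z) b
  obtain ⟨n, hnl, hn⟩ := (Nat.dvd_prime_pow hp).1 hβl
  have hnm := hnl.trans hlm
  have htop : Subgroup.zpowers β = ⊤ := by
    rw [eq_top_iff]
    intro x _
    obtain ⟨x, rfl⟩ := QuotientGroup.mk_surjective x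
    have hx : x ∈ Subgroup.closure {a, b} := hab ▸ Subgroup.mem_top x
    obtain ⟨i, j, rfl⟩ := Subgroup.mem_closure_pair.1 hx
    refine ⟨j, ?_⟩
    have h1 : (QuotientGroup.mk (a ^ i) : Q ⧸ Z) = 1 :=
      (QuotientGroup.eq_one_iff _).2 ⟨i, rfl⟩
    change β ^ j = QuotientGroup.mk (a ^ i) * QuotientGroup.mk (b ^ j)
    rw [h1, one_mul]
    rfl
  have hcard : Nat.card Q = p ^ (m + n) := by
    rw [Subgroup.card_eq_card_quotient_mul_card_subgroup Z, Nat.card_zpowers, ha,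
      ← Subgroup.card_top (G := Q ⧸ Z), ← htop, Nat.card_zpowers, hn, pow_add, mul_comm]
  have hbn : b ^ p ^ n ∈ Z := by
    rw [← QuotientGroup.eq_one_iff]
    change β ^ p ^ n = 1
    rw [← hn, pow_orderOf_eq_one]
  obtain ⟨i, hi⟩ := hbn
  have hi' : a ^ i = b ^ p ^ n := hi
  -- From b^(p^n) = a^i, raising to the power p^(m-n) gives 1, because the order of b does not
  -- exceed p^m. So i is divisible by p^n, and b can be corrected by a power of a.
  have hdvd : (p ^ n : ℤ) ∣ i := by
    have h1 : a ^ (i * (p ^ (m - n) : ℕ)) = 1 := by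
      rw [zpow_mul, hi', zpow_natCast, ← pow_mul, ← pow_add, Nat.add_sub_cancel' hnm]
      exact orderOf_dvd_iff_pow_eq_one.1 (hb ▸ pow_dvd_pow p hlm)
    rw [← orderOf_dvd_iff_zpow_eq_one, ha] at h1
    have h2 : ((p ^ m : ℕ) : ℤ) = (p ^ n : ℤ) * (p ^ (m - n) : ℕ) := by
      push_cast
      rw [← pow_add, Nat.add_sub_cancel' hnm]
    rw [h2] at h1
    refine Int.dvd_of_mul_dvd_mul_right ?_ h1
    exact_mod_cast pow_ne_zero _ hp.ne_zero
  obtain ⟨i', rfl⟩ := hdvd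
  refine ⟨-i', n, hnm, ?_, hcard⟩
  rw [mul_pow, ← hi', ← zpow_natCast (a ^ (-i')), ← zpow_mul, ← zpow_add]
  have : (p ^ n : ℤ) * i' + -i' * (p ^ n : ℕ) = 0 := by push_cast; ring
  rw [this, zpow_zero]

/-- Generators of a two-generated finite `p`-group adapted to a decomposition of its
abelianization. -/
structure AdaptedGenerators (p : ℕ) {G : Type*} [Group G] (a b : G) (m n : ℕ) : Prop where
  closure_eq_top : Subgroup.closure {a, b} = ⊤
  le : n ≤ m
  orderOf_left : orderOf (a : G ⧸ gam 2 G) = p ^ m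
  right_pow : b ^ p ^ n ∈ gam 2 G
  card : Nat.card (G ⧸ gam 2 G) = p ^ (m + n)
  pow_mem : ∀ g : G, g ^ p ^ m ∈ gam 2 G

theorem closure_pair_mul_zpow {G : Type*} [Group G] {a b : G} (k : ℤ)
    (hab : Subgroup.closure {a, b} = ⊤) : Subgroup.closure {a, b * a ^ k} = ⊤ := by
  rw [eq_top_iff, ← hab, Subgroup.closure_le]
  have ha : a ∈ Subgroup.closure {a, b * a ^ k} := Subgroup.subset_closure (by simp)
  have hb : b * a ^ k ∈ Subgroup.closure {a, b * a ^ k} := Subgroup.subset_closure (by simp)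
  rintro _ (rfl | rfl)
  · exact ha
  · have := Subgroup.mul_mem _ hb (Subgroup.inv_mem _ (Subgroup.zpow_mem _ ha k))
    rwa [mul_inv_cancel_right] at this

theorem exists_adaptedGenerators {G : Type*} [Group G] [Finite G] (hG : IsPGroup p G) {a b : G}
    (hab : Subgroup.closure {a, b} = ⊤) :
    ∃ (a' b' : G) (m n : ℕ), AdaptedGenerators p a' b' m n := by
  let inst : CommGroup (G ⧸ gam 2 G) :=
    { QuotientGroup.Quotient.group (gam 2 G) with mul_comm := quotient_gam_two_comm }
  have hQ : IsPGroup p (G ⧸ gam 2 G) := hG.to_quotient _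
  have key : ∀ (a b : G), Subgroup.closure {a, b} = ⊤ → ∀ m l : ℕ,
      orderOf (a : G ⧸ gam 2 G) = p ^ m → orderOf (b : G ⧸ gam 2 G) = p ^ l → l ≤ m →
      ∃ (a' b' : G) (m n : ℕ), AdaptedGenerators p a' b' m n := by
    intro a b hab m l ha hb hlm
    have hcl : Subgroup.closure {(a : G ⧸ gam 2 G), (b : G ⧸ gam 2 G)} = ⊤ := by
      have h1 := congrArg (Subgroup.map (QuotientGroup.mk' (gam 2 G))) hab
      rw [MonoidHom.map_closure, Set.image_pair, Subgroup.map_top_of_surjective _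
        (QuotientGroup.mk'_surjective _)] at h1
      exact h1
    obtain ⟨k, n, hnm, hk, hcard⟩ := exists_complement hcl ha hb hlm
    refine ⟨a, b * a ^ k, m, n, closure_pair_mul_zpow k hab, hnm, ha, ?_, hcard, fun g => ?_⟩
    · rw [← QuotientGroup.eq_one_iff]
      exact hk
    · rw [← QuotientGroup.eq_one_iff, QuotientGroup.mk_pow]
      have hg : (g : G ⧸ gam 2 G) ∈ Subgroup.closure {(a : G ⧸ gam 2 G), (b : G ⧸ gam 2 G)} :=
        hcl ▸ Subgroup.mem_top _
      obtain ⟨i, j, hij⟩ := Subgroup.mem_closure_pair.1 hg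
      have ha1 : (a : G ⧸ gam 2 G) ^ p ^ m = 1 := ha ▸ pow_orderOf_eq_one _
      have hb1 : (b : G ⧸ gam 2 G) ^ p ^ m = 1 :=
        orderOf_dvd_iff_pow_eq_one.1 (hb ▸ pow_dvd_pow p hlm)
      rw [← hij, mul_pow, ← zpow_natCast, ← zpow_natCast, zpow_comm, zpow_comm (b : G ⧸ gam 2 G),
        zpow_natCast, zpow_natCast, ha1, hb1, one_zpow, one_zpow, one_mul]
  obtain ⟨m, hm⟩ := (IsPGroup.iff_orderOf.1 hQ) (a : G ⧸ gam 2 G)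
  obtain ⟨l, hl⟩ := (IsPGroup.iff_orderOf.1 hQ) (b : G ⧸ gam 2 G)
  rcases le_total l m with hlm | hlm
  · exact key a b hab m l hm hl hlm
  · exact key b a (by rwa [Set.pair_comm]) l m hl hm hlm

end Groups

end BaginskiInvariant

/-! ### Matching generators and the isomorphism -/

namespace BaginskiInvariant

open MonoidAlgebra
open scoped commutatorElement

theorem closure_mk_eq_top {p : ℕ} {G : Type*} [Group G] {a b : G} (hab : Subgroup.closure {a, b} = ⊤) :
    Subgroup.closure {(a : G ⧸ kernelSubgroup p G), (b : G ⧸ kernelSubgroup p G)} = ⊤ := by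
  have h1 := congrArg (Subgroup.map (QuotientGroup.mk' (kernelSubgroup p G))) hab
  rw [MonoidHom.map_closure, Set.image_pair, Subgroup.map_top_of_surjective _
    (QuotientGroup.mk'_surjective _)] at h1
  exact h1

namespace IsModel

variable {p : ℕ} [Fact p.Prime] {G : Type*} [Group G] {A : Type*} [Ring A]
  {ε : A →+* ZMod p} {π : MonoidAlgebra (ZMod p) G →+* A}

theorem rho_mul_sub_one (h : IsModel ε π) (g : G) {n : G} {m : A} (hm : m ∈ commIdeal A)
    (hn : rho π n = 1 + m) : rho π (g * n) - 1 = rho π g - 1 + m := by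
  rw [map_mul, hn, mul_add, mul_one, h.mul_eq_self g hm]
  abel

/-- The power is additive on x plus an element of D², either by p^k ≥ 3 or because MD = 0 makes the
two commute, and it vanishes on D². -/
theorem pow_eq_pow (h : IsModel ε π) {k : ℕ} (hk : k ≠ 0)
    (hD : ∀ x ∈ RingHom.ker ε, x ^ p ^ k ∈ commIdeal A)
    (hadd : 3 ≤ p ^ k ∨ ∀ z ∈ commIdeal A * RingHom.ker ε, z = 0) {x x' : A}
    (hx : x ∈ RingHom.ker ε) (hxx' : x - x' ∈ RingHom.ker ε * RingHom.ker ε) :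
    x ^ p ^ k = x' ^ p ^ k := by
  have hchar := h.charP
  have hS := h.isSmall
  have e : x' = x + -(x - x') := by abel
  have hneg : -(x - x') ∈ RingHom.ker ε * RingHom.ker ε := Ideal.neg_mem_iff _ |>.2 hxx'
  have h0' := hS.sq_pow_eq_zero hk hD hneg
  have hkey : (x + -(x - x')) ^ p ^ k = x ^ p ^ k + (-(x - x')) ^ p ^ k := by
    rcases hadd with h3 | hz
    · exact hS.add_pow_of_mem_sq h3 hx hneg
    · refine add_pow_char_pow_of_commute _ _ ?_
      rw [commute_iff_eq, ← sub_eq_zero]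
      exact hz _ (hS.comm_mem_M_mul_D x hneg)
  rw [e, hkey, h0', add_zero]

/-- Two elements of the augmentation ideal spanning it modulo its square, with `p ^ m`-th and
`p ^ n`-th powers in `M`, can be matched by group elements: there are `a'`, `b'` in the group such
that `a' - 1` and `b' - 1` agree with them modulo `D²` and have the same powers and the same
commutator. -/
theorem exists_match [Finite G] (h : IsModel ε π) {a b : G} {m n : ℕ}
    (hab : AdaptedGenerators p a b m n) {x y : A} (hxy : Spans (RingHom.ker ε) x y)
    (hyM : y ^ p ^ n ∈ commIdeal A) :
    ∃ a' b' : G, x - (rho π a' - 1) ∈ RingHom.ker ε * RingHom.ker ε ∧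
      y - (rho π b' - 1) ∈ RingHom.ker ε * RingHom.ker ε ∧
      x ^ p ^ m = (rho π a' - 1) ^ p ^ m ∧ y ^ p ^ n = (rho π b' - 1) ^ p ^ n ∧
      x * y - y * x = (rho π a' - 1) * (rho π b' - 1) - (rho π b' - 1) * (rho π a' - 1) := by
  have hchar := h.charP
  have hS := h.isSmall
  have hp := (Fact.out : p.Prime)
  have hD := (h.pow_mem_iff m).1 hab.pow_mem
  have hXY := h.spans_of_closure hab.closure_eq_top
  obtain ⟨a₀, ha₀⟩ := h.exists_lift hxy.left_mem
  have ha₀D := h.rho_sub_one_mem a₀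
  -- changing both elements by elements of `γ₂`
  have adjust : ∀ b₀ : G, n ≠ 0 → 3 ≤ p ^ n →
      y - (rho π b₀ - 1) ∈ RingHom.ker ε * RingHom.ker ε →
      y ^ p ^ n = (rho π b₀ - 1) ^ p ^ n →
      ∃ a' b' : G, x - (rho π a' - 1) ∈ RingHom.ker ε * RingHom.ker ε ∧
      y - (rho π b' - 1) ∈ RingHom.ker ε * RingHom.ker ε ∧
      x ^ p ^ m = (rho π a' - 1) ^ p ^ m ∧ y ^ p ^ n = (rho π b' - 1) ^ p ^ n ∧
      x * y - y * x = (rho π a' - 1) * (rho π b' - 1) - (rho π b' - 1) * (rho π a' - 1) := by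
    intro b₀ hn h3 hb₀ hb₀p
    have hm3 : 3 ≤ p ^ m := h3.trans (Nat.pow_le_pow_right hp.pos hab.le)
    have hm : m ≠ 0 := by rintro rfl; simp at hm3
    have hs := hxy.congr hS.sq_le ha₀ hb₀
    obtain ⟨μ, hμ, ν, hν, hμν⟩ := exists_comm_add_eq hS hs (comm_sub_comm_mem hS ha₀ hb₀)
    obtain ⟨k, -, hk⟩ := h.exists_rho_eq hμ
    obtain ⟨l, -, hl⟩ := h.exists_rho_eq hν
    have hak := h.rho_mul_sub_one a₀ hμ hk
    have hbl := h.rho_mul_sub_one b₀ hν hl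
    have hx' : x - (rho π (a₀ * k) - 1) ∈ RingHom.ker ε * RingHom.ker ε := by
      rw [hak, ← sub_sub]
      exact Ideal.sub_mem _ ha₀ (hS.M_le hμ)
    have hy' : y - (rho π (b₀ * l) - 1) ∈ RingHom.ker ε * RingHom.ker ε := by
      rw [hbl, ← sub_sub]
      exact Ideal.sub_mem _ hb₀ (hS.M_le hν)
    refine ⟨a₀ * k, b₀ * l, hx', hy', h.pow_eq_pow hm hD (Or.inl hm3) hxy.left_mem hx', ?_, ?_⟩
    · rw [hbl, hS.add_pow_of_mem_sq h3 (h.rho_sub_one_mem b₀) (hS.M_le hν),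
        hS.M_pow hν (by omega), add_zero, hb₀p]
    · rw [hak, hbl, hμν]
      abel
  -- no change is necessary if `M D = 0`
  have trivial_case : ∀ b₀ : G, (∀ z ∈ commIdeal A * RingHom.ker ε, z = 0) → m ≠ 0 →
      y - (rho π b₀ - 1) ∈ RingHom.ker ε * RingHom.ker ε →
      y ^ p ^ n = (rho π b₀ - 1) ^ p ^ n →
      ∃ a' b' : G, x - (rho π a' - 1) ∈ RingHom.ker ε * RingHom.ker ε ∧
      y - (rho π b' - 1) ∈ RingHom.ker ε * RingHom.ker ε ∧
      x ^ p ^ m = (rho π a' - 1) ^ p ^ m ∧ y ^ p ^ n = (rho π b' - 1) ^ p ^ n ∧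
      x * y - y * x = (rho π a' - 1) * (rho π b' - 1) - (rho π b' - 1) * (rho π a' - 1) := by
    intro b₀ hz hm hb₀ hb₀p
    exact ⟨a₀, b₀, ha₀, hb₀, h.pow_eq_pow hm hD (Or.inr hz) hxy.left_mem ha₀, hb₀p,
      sub_eq_zero.1 (hz _ (comm_sub_comm_mem hS ha₀ hb₀))⟩
  -- The exceptional case is p^n = 2, where adding ν in M to y would change y² by νy.
  have hlt3 : ¬ 3 ≤ p ^ n → n ≠ 0 → p = 2 ∧ n = 1 := by
    intro h3 hn
    have h2 : p ≤ p ^ n := Nat.le_self_pow hn p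
    have hp2 : p = 2 := le_antisymm (by omega) hp.two_le
    refine ⟨hp2, ?_⟩
    rw [hp2] at h3
    by_contra hn1
    have : 2 ^ 2 ≤ 2 ^ n := Nat.pow_le_pow_right (by norm_num) (by omega)
    omega
  rcases Nat.eq_zero_or_pos n with rfl | hn
  · -- the abelianization is cyclic
    have hbM := (h.rho_sub_one_mem_commIdeal_iff b).2 (by simpa using hab.right_pow)
    have hMD : ∀ z ∈ commIdeal A * RingHom.ker ε, z = 0 := fun z hz =>
      M_mul_D_eq_zero_of_mem_sq hS hXY (hS.M_le hbM) hz
    have hM : ∀ z ∈ commIdeal A, z = 0 := by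
      intro z hz
      obtain ⟨r, hr⟩ := exists_sub_zsmul_comm_mem hS hXY hz
      have h1 := hMD _ hr
      rw [hS.D_mul_M hXY.left_mem hbM, hMD _ (Ideal.mul_mem_mul hbM hXY.left_mem), sub_zero,
        smul_zero, sub_zero] at h1
      exact h1
    have hy0 : y = 0 := hM y (by simpa using hyM)
    rcases Nat.eq_zero_or_pos m with rfl | hm
    · have hD0 : ∀ v ∈ RingHom.ker ε, v = 0 := fun v hv => hM v (by simpa using hD v hv)
      refine ⟨1, 1, ?_⟩
      simp [hy0, hD0 x hxy.left_mem]
    · refine trivial_case 1 hMD hm.ne' ?_ ?_ <;> simp [hy0]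
  rcases hab.le.eq_or_lt with rfl | hnm
  · obtain ⟨b₀, hb₀⟩ := h.exists_lift hxy.right_mem
    by_cases h3 : 3 ≤ p ^ n
    · exact adjust b₀ hn.ne' h3 hb₀ (h.pow_eq_pow hn.ne' hD (Or.inl h3) hxy.right_mem hb₀)
    · obtain ⟨rfl, rfl⟩ := hlt3 h3 hn.ne'
      have hMD : ∀ z ∈ commIdeal A * RingHom.ker ε, z = 0 := fun z hz =>
        M_mul_D_eq_zero_of_sq_mem hS hXY (by simpa using hD) hz
      exact trivial_case b₀ hMD one_ne_zero hb₀
        (h.pow_eq_pow one_ne_zero hD (Or.inr hMD) hxy.right_mem hb₀)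
  · obtain ⟨b₀, s, hb₀, hb₀p, hs⟩ :=
      h.exists_pow_eq hab.closure_eq_top hn.ne' hnm hab.orderOf_left hab.right_pow hyM
    by_cases h3 : 3 ≤ p ^ n
    · exact adjust b₀ hn.ne' h3 hb₀ hb₀p
    obtain ⟨rfl, rfl⟩ := hlt3 h3 hn.ne'
    have h2 : ∀ v : A, (2 : ℤ) • v = 0 := fun v => by
      have : (2 : A) = 0 := by exact_mod_cast CharP.cast_eq_zero A 2
      rw [zsmul_eq_mul]; push_cast; rw [this, zero_mul]
    have hm0 : m ≠ 0 := by omega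
    have hm3 : 3 ≤ 2 ^ m := by
      have : 2 ^ 2 ≤ 2 ^ m := Nat.pow_le_pow_right (by norm_num) hnm
      omega
    -- In characteristic two, s even puts y in D², so MD = 0; s odd gives b₀ - 1 ≡ b - 1, and the
    -- correction is made on the other generator alone.
    rcases Int.even_or_odd' s with ⟨t, rfl | rfl⟩
    · rw [mul_comm, mul_smul, h2, smul_zero, sub_zero] at hs
      have hysq : y ∈ RingHom.ker ε * RingHom.ker ε := by
        have := Ideal.add_mem _ hb₀ hs
        rwa [sub_add_cancel] at this
      exact trivial_case b₀ (fun z hz => M_mul_D_eq_zero_of_mem_sq hS hxy hysq hz) hm0 hb₀ hb₀p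
    · rw [add_smul, mul_comm, mul_smul, h2, smul_zero, zero_add, one_smul] at hs
      obtain ⟨i, μ, hμ, x', hx', hxx', hcomm⟩ := exists_comm_add_eq_of_char_two hS hXY ha₀D hs
        (comm_sub_comm_mem hS ha₀ hb₀)
      obtain ⟨k, -, hk⟩ := h.exists_rho_eq hμ
      have hrho : rho π (a₀ * a ^ (2 * i) * k) - 1 = x' := by
        rw [map_mul, map_mul, map_pow, hk, sub_eq_iff_eq_add, add_comm x', hx',
          add_sub_cancel, add_sub_cancel]
      have hx1 : x - x' ∈ RingHom.ker ε * RingHom.ker ε := by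
        have := Ideal.add_mem _ ha₀ hxx'
        rwa [sub_add_sub_cancel] at this
      refine ⟨a₀ * a ^ (2 * i) * k, b₀, ?_, hb₀, ?_, hb₀p, ?_⟩
      · rw [hrho]; exact hx1
      · rw [hrho]; exact h.pow_eq_pow hm0 hD (Or.inl hm3) hxy.left_mem hx1
      · rw [hrho, hcomm]
        abel

/-- The embedding of `G / γ₂(G)^p γ₄(G)` into the ring of a model. -/
noncomputable def quotientHom (h : IsModel ε π) : G ⧸ kernelSubgroup p G →* A :=
  QuotientGroup.lift (kernelSubgroup p G) (rho π) fun g hg => (h.rho_eq_one_iff g).2 hg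

theorem quotientHom_mk (h : IsModel ε π) (g : G) : h.quotientHom (g : G ⧸ kernelSubgroup p G) =
    rho π g := rfl

theorem quotientHom_injective (h : IsModel ε π) : Function.Injective h.quotientHom := by
  intro x y hxy
  obtain ⟨x, rfl⟩ := QuotientGroup.mk_surjective x
  obtain ⟨y, rfl⟩ := QuotientGroup.mk_surjective y
  rw [h.quotientHom_mk, h.quotientHom_mk] at hxy
  rw [QuotientGroup.eq, ← h.rho_eq_one_iff, map_mul, ← hxy, rho_inv_mul]

variable {H : Type*} [Group H] {π' : MonoidAlgebra (ZMod p) H →+* A}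

/-- Because M D² = 0, right multiplication on M depends only on the class modulo D². As group
elements act trivially on M from the left, so does conjugation on 1 + M. -/
theorem mul_rho_inv_eq (h : IsModel ε π) {g : G} {k : H}
    (hgk : rho π' k - rho π g ∈ RingHom.ker ε * RingHom.ker ε) {m : A} (hm : m ∈ commIdeal A) :
    m * rho π g⁻¹ = m * rho π' k⁻¹ := by
  have h1 : m * rho π g⁻¹ * (rho π' k - rho π g) = 0 :=
    h.isSmall.M_mul_sq (Ideal.mul_mem_right _ _ hm) hgk
  rw [mul_sub, mul_assoc _ _ (rho π g), rho_inv_mul, mul_one, sub_eq_zero] at h1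
  calc m * rho π g⁻¹ = m * rho π g⁻¹ * (rho π' k * rho π' k⁻¹) := by rw [rho_mul_inv, mul_one]
    _ = m * rho π' k⁻¹ := by rw [← mul_assoc, h1]

theorem exponent_le (h : IsModel ε π) (h' : IsModel ε π') {a b : G} {c d : H} {m n m' n' : ℕ}
    (hab : AdaptedGenerators p a b m n) (hcd : AdaptedGenerators p c d m' n') : m ≤ m' := by
  have h1 := (h.pow_mem_iff m').2 ((h'.pow_mem_iff m').1 hcd.pow_mem) a
  rw [← QuotientGroup.eq_one_iff, QuotientGroup.mk_pow, ← orderOf_dvd_iff_pow_eq_one,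
    hab.orderOf_left] at h1
  exact (Nat.pow_dvd_pow_iff_le_right (Fact.out : p.Prime).one_lt).1 h1

/-- Two finite `p`-groups with models in the same augmented ring, one of them two-generated, have
isomorphic quotients by `γ₂^p γ₄`. -/
theorem nonempty_mulEquiv [Finite G] [Finite H] (h : IsModel ε π) (h' : IsModel ε π')
    (hG : IsPGroup p G) (hH : IsPGroup p H) (hgen : ∃ a b : G, Subgroup.closure {a, b} = ⊤) :
    Nonempty ((G ⧸ kernelSubgroup p G) ≃* (H ⧸ kernelSubgroup p H)) := by
  have hp := (Fact.out : p.Prime)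
  have hchar := h.charP
  have hS := h.isSmall
  obtain ⟨a, b, hab⟩ := hgen
  -- D/D² is spanned by two elements, so H is two-generated as well.
  obtain ⟨c, d, hcd⟩ := h'.exists_spans (h.spans_of_closure hab)
  obtain ⟨a, b, m, n, hab⟩ := exists_adaptedGenerators hG hab
  obtain ⟨c, d, m', n', hcd⟩ := exists_adaptedGenerators hH (h'.closure_eq_top hH hcd)
  obtain rfl : m = m' := le_antisymm (h.exponent_le h' hab hcd) (h'.exponent_le h hcd hab)
  have hcardab : Nat.card (G ⧸ gam 2 G) = Nat.card (H ⧸ gam 2 H) :=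
    Nat.pow_right_injective hp.two_le
      (h.card_quotient_commIdeal.symm.trans h'.card_quotient_commIdeal)
  obtain rfl : n = n' := by
    have h1 := hcardab
    rw [hab.card, hcd.card] at h1
    have := Nat.pow_right_injective hp.two_le h1
    omega
  have hpow : ∀ g : H, ∀ k : ℕ, (rho π' g - 1) ^ p ^ k = rho π' (g ^ p ^ k) - 1 := fun g k => by
    rw [sub_pow_char_pow_of_commute _ _ (Commute.one_right _), one_pow, map_pow]
  have hpowG : ∀ g : G, ∀ k : ℕ, (rho π g - 1) ^ p ^ k = rho π (g ^ p ^ k) - 1 := fun g k => by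
    rw [sub_pow_char_pow_of_commute _ _ (Commute.one_right _), one_pow, map_pow]
  have hxM : (rho π' c - 1) ^ p ^ m ∈ commIdeal A := by
    rw [hpow, h'.rho_sub_one_mem_commIdeal_iff]
    exact hcd.pow_mem c
  have hyM : (rho π' d - 1) ^ p ^ n ∈ commIdeal A := by
    rw [hpow, h'.rho_sub_one_mem_commIdeal_iff]
    exact hcd.right_pow
  have hspan := h'.spans_of_closure hcd.closure_eq_top
  obtain ⟨a', b', ha', hb', hap, hbp, hcomm⟩ := h.exists_match hab hspan hyM
  have htop : Subgroup.closure {a', b'} = ⊤ :=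
    h.closure_eq_top hG (hspan.congr hS.sq_le ha' hb')
  rw [sub_sub_sub_cancel_right] at ha' hb'
  rw [hpow] at hxM hyM
  rw [hpow, hpowG, sub_left_inj] at hap hbp
  let φ := h.quotientHom
  let ψ := h'.quotientHom
  -- The common copy of 1 + M: pairs with the same image in A, lying in 1 + M.
  let T : Subgroup ((G ⧸ kernelSubgroup p G) × (H ⧸ kernelSubgroup p H)) :=
    { carrier := {t | φ t.1 = ψ t.2 ∧ φ t.1 - 1 ∈ commIdeal A}
      one_mem' := ⟨by simp, by simp⟩
      mul_mem' := by
        rintro ⟨u, v⟩ ⟨u', v'⟩ ⟨h1, h2⟩ ⟨h3, h4⟩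
        refine ⟨by simp only [Prod.fst_mul, Prod.snd_mul, map_mul] at *; rw [h1, h3], ?_⟩
        have e : φ (u * u') - 1 = φ u * (φ u' - 1) + (φ u - 1) := by
          rw [map_mul, mul_sub, mul_one]; abel
        change φ (u * u') - 1 ∈ _
        rw [e]
        exact Ideal.add_mem _ (Ideal.mul_mem_left _ _ h4) h2
      inv_mem' := by
        rintro ⟨u, v⟩ ⟨h1, h2⟩
        have hu : φ u⁻¹ * φ u = 1 := by rw [← map_mul, inv_mul_cancel, map_one]
        have hv : ψ v * ψ v⁻¹ = 1 := by rw [← map_mul, mul_inv_cancel, map_one]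
        refine ⟨?_, ?_⟩
        · change φ u⁻¹ = ψ v⁻¹
          calc φ u⁻¹ = φ u⁻¹ * (ψ v * ψ v⁻¹) := by rw [hv, mul_one]
            _ = φ u⁻¹ * φ u * ψ v⁻¹ := by rw [mul_assoc, show φ u = ψ v from h1]
            _ = ψ v⁻¹ := by rw [hu, one_mul]
        · change φ u⁻¹ - 1 ∈ _
          have e : φ u⁻¹ - 1 = -(φ u⁻¹ * (φ u - 1)) := by rw [mul_sub, hu, mul_one]; abel
          rw [e]
          exact Ideal.neg_mem_iff _ |>.2 (Ideal.mul_mem_left _ _ h2) }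
  have hconj : ∀ (g : G) (k : H), rho π' k - rho π g ∈ RingHom.ker ε * RingHom.ker ε →
      ∀ t ∈ T, ((g : G ⧸ kernelSubgroup p G), (k : H ⧸ kernelSubgroup p H)) * t *
        ((g : G ⧸ kernelSubgroup p G), (k : H ⧸ kernelSubgroup p H))⁻¹ ∈ T := by
    rintro g k hgk ⟨u, v⟩ ⟨h1, h2⟩
    have h1' : φ u = ψ v := h1
    have e1 : φ (g * u * (g : G ⧸ kernelSubgroup p G)⁻¹) = 1 + (φ u - 1) * rho π g⁻¹ := by
      rw [map_mul, map_mul, ← QuotientGroup.mk_inv]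
      change rho π g * φ u * rho π g⁻¹ = _
      have e : rho π g * φ u = rho π g + rho π g * (φ u - 1) := by rw [mul_sub, mul_one]; abel
      rw [e, h.mul_eq_self g h2, add_mul, rho_mul_inv]
    have e2 : ψ (k * v * (k : H ⧸ kernelSubgroup p H)⁻¹) = 1 + (φ u - 1) * rho π' k⁻¹ := by
      rw [map_mul, map_mul, ← QuotientGroup.mk_inv]
      change rho π' k * ψ v * rho π' k⁻¹ = _
      have e : rho π' k * ψ v = rho π' k + rho π' k * (φ u - 1) := by
        rw [h1', mul_sub, mul_one]; abel
      rw [e, h'.mul_eq_self k h2, add_mul, rho_mul_inv]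
    refine ⟨?_, ?_⟩
    · change φ (g * u * (g : G ⧸ kernelSubgroup p G)⁻¹) =
        ψ (k * v * (k : H ⧸ kernelSubgroup p H)⁻¹)
      rw [e1, e2, h.mul_rho_inv_eq hgk h2]
    · change φ (g * u * (g : G ⧸ kernelSubgroup p G)⁻¹) - 1 ∈ _
      rw [e1, add_sub_cancel_left]
      exact Ideal.mul_mem_right _ _ h2
  have hfin : Finite A := by
    have : Finite (MonoidAlgebra (ZMod p) G) := Finite.of_equiv (G → ZMod p)
      (MonoidAlgebra.coeffEquiv.trans Finsupp.equivFunOnFinite).symm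
    exact Finite.of_surjective π h.surj
  have hT : Nat.card T ≤ Nat.card (commIdeal A) := by
    refine Nat.card_le_card_of_injective
      (fun t : T => (⟨φ t.1.1 - 1, t.2.2⟩ : commIdeal A)) ?_
    rintro ⟨⟨u, v⟩, h1, h2⟩ ⟨⟨u', v'⟩, h3, h4⟩ huv
    have h5 : φ u = φ u' := sub_left_inj.1 (congrArg Subtype.val huv)
    have h6 : ψ v = ψ v' := by
      rw [← show φ u = ψ v from h1, h5]
      exact h3
    have h7 := h.quotientHom_injective h5
    have h8 := h'.quotientHom_injective h6
    subst h7 h8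
    rfl
  have hcM : ∀ g k : A, (g - 1) * (k - 1) - (k - 1) * (g - 1) = g * k - k * g := fun g k => by
    noncomm_ring
  rw [hcM, hcM] at hcomm
  refine nonempty_mulEquiv_of_pairs T ((a' : G ⧸ kernelSubgroup p G), (c : H ⧸ kernelSubgroup p H))
    ((b' : G ⧸ kernelSubgroup p G), (d : H ⧸ kernelSubgroup p H)) (P := p ^ m) (Q := p ^ n)
    (pow_ne_zero _ hp.ne_zero) (pow_ne_zero _ hp.ne_zero) (hconj a' c ha') (hconj b' d hb')
    ?_ ?_ ?_ ?_ ?_ (closure_mk_eq_top htop) (closure_mk_eq_top hcd.closure_eq_top)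
  · have hM := comm_mem_commIdeal (rho π a') (rho π b')
    have e1 : rho π ⁅a', b'⁆ = 1 + (rho π a' * rho π b' - rho π b' * rho π a') *
        rho π a'⁻¹ * rho π b'⁻¹ := by
      rw [rho_commutator, map_mul, mul_assoc]
    have e2 : rho π' ⁅c, d⁆ = rho π ⁅a', b'⁆ := by
      rw [e1, rho_commutator, hcomm, map_mul, ← mul_assoc, h.mul_rho_inv_eq ha' hM,
        h.mul_rho_inv_eq hb' (Ideal.mul_mem_right _ _ hM)]
    refine ⟨e2.symm, ?_⟩
    change rho π ⁅a', b'⁆ - 1 ∈ _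
    rw [e1, add_sub_cancel_left]
    exact Ideal.mul_mem_right _ _ (Ideal.mul_mem_right _ _ hM)
  · refine ⟨hap.symm, ?_⟩
    change rho π (a' ^ p ^ m) - 1 ∈ _
    rw [← hap]
    exact hxM
  · refine ⟨hbp.symm, ?_⟩
    change rho π (b' ^ p ^ n) - 1 ∈ _
    rw [← hbp]
    exact hyM
  · rw [h.card_quotient_kernelSubgroup, hab.card, pow_add]
    exact Nat.mul_le_mul_right _ hT
  · rw [h'.card_quotient_kernelSubgroup, hcd.card, pow_add]
    exact Nat.mul_le_mul_right _ hT

end IsModel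

/-! ### From group algebras to a common model -/

section Transfer

variable {p : ℕ} [Fact p.Prime] {G H : Type*} [Group G] [Group H]

/-- The image of g has some p^k-th power equal to 1, and Frobenius is the identity on the prime
field, so its augmentation is 1. -/
theorem aug_map_eq (hG : IsPGroup p G)
    (Ψ : MonoidAlgebra (ZMod p) G →+* MonoidAlgebra (ZMod p) H) (r : MonoidAlgebra (ZMod p) G) :
    aug p H (Ψ r) = aug p G r := by
  refine algebra_induction r (fun g => ?_) (by simp) (fun x y hx hy => ?_)
  · obtain ⟨k, hk⟩ := hG g
    rw [aug_of, ← ZMod.pow_card_pow (n := k) (aug p H (Ψ _)), ← map_pow, ← map_pow, ← map_pow, hk,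
      map_one, map_one, map_one]
  · rw [map_add, map_add, hx, hy, map_add]

theorem nonempty_mulEquiv_of_ringEquiv [Finite G] [Finite H] (hG : IsPGroup p G)
    (hH : IsPGroup p H) (hgen : ∃ a b : G, Subgroup.closure {a, b} = ⊤)
    (Ψ : MonoidAlgebra (ZMod p) G ≃+* MonoidAlgebra (ZMod p) H) :
    Nonempty ((G ⧸ kernelSubgroup p G) ≃* (H ⧸ kernelSubgroup p H)) := by
  let I := smallIdeal (aug p G)
  let π : MonoidAlgebra (ZMod p) G →+* MonoidAlgebra (ZMod p) G ⧸ I := Ideal.Quotient.mk I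
  have hI : ∀ r ∈ I, aug p G r = 0 := fun r hr =>
    ker_sq_le_ker _ (smallIdeal_le_ker_sq _ hr)
  let ε : MonoidAlgebra (ZMod p) G ⧸ I →+* ZMod p := Ideal.Quotient.lift I (aug p G) hI
  have h : IsModel ε π :=
    { surj := Ideal.Quotient.mk_surjective
      ker := fun r => Ideal.Quotient.eq_zero_iff_mem
      aug := fun r => Ideal.Quotient.lift_mk I _ hI }
  have hΨ := aug_map_eq hG (Ψ : MonoidAlgebra (ZMod p) G →+* MonoidAlgebra (ZMod p) H)
  have hΨ' := aug_map_eq hH (Ψ.symm : MonoidAlgebra (ZMod p) H →+* MonoidAlgebra (ZMod p) G)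
  have h' : IsModel ε (π.comp (Ψ.symm : MonoidAlgebra (ZMod p) H →+* MonoidAlgebra (ZMod p) G)) :=
    { surj := Ideal.Quotient.mk_surjective.comp Ψ.symm.surjective
      ker := fun r => by
        refine Iff.trans Ideal.Quotient.eq_zero_iff_mem ⟨fun hr => ?_, fun hr => ?_⟩
        · have hr' := smallIdeal_le_comap _ _ _ hΨ hr
          exact Ψ.apply_symm_apply r ▸ Ideal.mem_comap.1 hr'
        · exact smallIdeal_le_comap _ _ _ hΨ' hr
      aug := fun r => (h.aug _).trans (hΨ' r) }
  exact h.nonempty_mulEquiv h' hG hH hgen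

end Transfer

end BaginskiInvariant

theorem mainTheorem3 (p : ℕ) (hp : p.Prime)
    (k : Type*) [Field k] (hk : Nat.card k = p)
    (G : Type*) [Group G] [Finite G] (hG : IsPGroup p G)
    (H : Type*) [Group H] [Finite H] (hH : IsPGroup p H)
    (hgen : ∃ a b : G, Subgroup.closure {a, b} = ⊤)
    (hkGH : Nonempty (MonoidAlgebra k G ≃ₐ[k] MonoidAlgebra k H)) :
    Nonempty ((G ⧸ BaginskiInvariant.kernelSubgroup p G) ≃*
      (H ⧸ BaginskiInvariant.kernelSubgroup p H)) := by
  have : Fact p.Prime := ⟨hp⟩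
  have : Finite k := Nat.finite_of_card_ne_zero (hk ▸ hp.ne_zero)
  let : Fintype k := Fintype.ofFinite k
  let e : ZMod p ≃+* k := ZMod.ringEquivOfPrime k hp (by rw [← Nat.card_eq_fintype_card, hk])
  obtain ⟨Φ⟩ := hkGH
  exact BaginskiInvariant.nonempty_mulEquiv_of_ringEquiv hG hH hgen
    (((MonoidAlgebra.mapRingEquiv G e).trans Φ.toRingEquiv).trans
      (MonoidAlgebra.mapRingEquiv H e.symm))
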